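/- Let $\mathbb F_q$ be a finite field with $q$ elements, $q$ odd, let $G=GL_2(\mathbb F_q)$, let $B\subset G$ be the subgroup of upper triangular matrices, and let $\mathbb F_{q^2}\supset\mathbb F_q$ be a quadratic extension. Fix a basis of $\mathbb F_{q^2}$ over $\mathbb F_q$ and let $K\subset G$ be the group of matrices of multiplication by elements of $\mathbb F_{q^2}^\times$, so $K\cong\mathbb F_{q^2}^\times$. For a subgroup $H\subset G$ and a complex representation $V$ of $H$, $\mathrm{Ind}_H^G V=\{f:G\to V \mid f(hx)=h f(x)\ \forall h\in H, x\in G\}$ with $(gf)(x)=f(xg)$. All characters below are homomorphisms to $\mathbb C^\times$. 1. (One-dimensional representations.) For a character $\xi$ of $\mathbb F_q^\times$ let $\mathbb C_\xi$ be the one-dimensional representation $\xi\circ\det$ of $G$. Every one-dimensional complex representation of $G$ is isomorphic to some $\mathbb C_\xi$; $\mathbb C_\xi\cong\mathbb C_{\xi'}$ if and only if $\xi=\xi'$; there are exactly $q-1$ of them up to isomorphism. 2. (Principal series.) For characters $\lambda_1,\lambda_2$ of $\mathbb F_q^\times$ let $V_{\lambda_1,\lambda_2}=\mathrm{Ind}_B^G\lambda$,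 where $\lambda\begin{pmatrix}a&b\\0&c\end{pmatrix}=\lambda_1(a)\lambda_2(c)$. Then $\dim V_{\lambda_1,\lambda_2}=q+1$. If $\lambda_1\ne\lambda_2$, then $V_{\lambda_1,\lambda_2}$ is irreducible. If $\lambda_1\neq\lambda_2$ and $\lambda_1'\ne\lambda_2'$, then $V_{\lambda_1,\lambda_2}\cong V_{\lambda_1',\lambda_2'}$ if and only if $\{\lambda_1,\lambda_2\}=\{\lambda_1',\lambda_2'\}$. There are exactly $(q-1)(q-2)/2$ isomorphism classes of such $V_{\lambda_1,\lambda_2}$ with $\lambda_1\neq\lambda_2$. 3. (The representations $W_\mu$.) For a character $\mu$ of $\mathbb F_q^\times$, let $W_\mu\subset V_{\mu,\mu}$ be the invariant subspace of those $f$ with $\sum_{g\in G}\mu(\det g)^{-1}f(g)=0$. Then $V_{\mu,\mu}\cong\mathbb C_\mu\oplus W_\mu$, and $W_\mu$ is irreducible of dimension $q$. Moreover $W_\mu\cong W_{\mu'}$ if and only if $\mu=\mu'$, and there are exactly $q-1$ of them up to isomorphism. 4. (Complementary series.) For every character $\nu$ of $\mathbb F_{q^2}^\times$ with $\nu^q\ne\nu$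 there is an irreducible representation $Y_\nu$ of $G$ of dimension $q-1$ whose character is that of the virtual representation $W_1\otimes V_{\alpha,1}-V_{\alpha,1}-\mathrm{Ind}_K^G\nu$, where $\alpha=\nu|_{\mathbb F_q^\times}$ and $1$ is the trivial character of $\mathbb F_q^\times$. For $\nu,\nu'$ with $\nu^q\neq\nu$ and $\nu'^q\ne\nu'$, $Y_\nu\cong Y_{\nu'}$ if and only if $\nu'\in\{\nu,\nu^q\}$. There are exactly $q(q-1)/2$ of them up to isomorphism. 5. (Completeness.) Every irreducible complex representation of $G$ is isomorphic to some $\mathbb C_\xi$, to some $V_{\lambda_1,\lambda_2}$ with $\lambda_1\neq\lambda_2$, to some $W_\mu$, or to some $Y_\nu$ with $\nu^q\ne\nu$. Up to isomorphism $G$ has exactly $q^2-1$ irreducible complex representations. -/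

import Mathlib

open Representation

namespace GL2Rep

noncomputable section

section General

variable {G : Type*} [Group G]

/-- The one-dimensional representation `ℂ_χ` attached to a character `χ : G → ℂˣ`:
the element `g` acts on `ℂ` by multiplication by `χ g`. -/
def charRep (χ : G →* ℂˣ) : Representation ℂ G ℂ :=
  (Algebra.lmul ℂ ℂ : ℂ →* Module.End ℂ ℂ).comp ((Units.coeHom ℂ).comp χ)

@[simp]
theorem charRep_apply (χ : G →* ℂˣ) (g : G) (z : ℂ) : charRep χ g z = (χ g : ℂ) * z := rfl

variable (G) in
/-- Finite-dimensional complex representations of `G`, in coordinates. -/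
abbrev FinRep : Type _ := Σ n : ℕ, Representation ℂ G (Fin n → ℂ)

/-- Isomorphism of representations, as an equivalence relation. -/
instance finRepSetoid : Setoid (FinRep G) where
  r ρ σ := Nonempty (ρ.2.Equiv σ.2)
  iseqv :=
    { refl := fun ρ => ⟨Representation.Equiv.refl ρ.2⟩
      symm := fun ⟨e⟩ => ⟨e.symm⟩
      trans := fun ⟨e⟩ ⟨f⟩ => ⟨e.trans f⟩ }

/-- The set of isomorphism classes of finite-dimensional complex representations `ρ` of `G`
that have the property `P`. -/
def isoClasses (P : FinRep G → Prop) : Set (Quotient (finRepSetoid (G := G))) :=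
  (fun ρ => Quotient.mk _ ρ) '' {ρ : FinRep G | P ρ}

end General

section Borel

variable (F : Type*) [Field F]

/-- The group `B` of invertible upper triangular `2 × 2` matrices. -/
def borel : Subgroup (GL (Fin 2) F) where
  carrier := {g | g 1 0 = 0}
  one_mem' := by simp
  mul_mem' := by
    intro a b ha hb
    simp only [Set.mem_ofPred_eq] at *
    simp [Matrix.mul_apply, Fin.sum_univ_two, ha, hb]
  inv_mem' := by
    intro a ha
    simp only [Set.mem_ofPred_eq] at *
    rw [Matrix.coe_units_inv, Matrix.inv_def, Matrix.adjugate_fin_two]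
    simp [ha]

variable {F}

theorem mem_borel {g : GL (Fin 2) F} : g ∈ borel F ↔ g 1 0 = 0 := Iff.rfl

theorem borel_diag_ne_zero (g : borel F) (i : Fin 2) : (g : GL (Fin 2) F) i i ≠ 0 := by
  have hdet : (g : GL (Fin 2) F).val.det ≠ 0 := (Matrix.isUnits_det_units g.1).ne_zero
  have h0 := mem_borel.1 g.2
  rw [Matrix.det_fin_two, h0, mul_zero, sub_zero] at hdet
  fin_cases i
  · exact left_ne_zero_of_mul hdet
  · exact right_ne_zero_of_mul hdet

/-- The homomorphism `B → Fˣ` that takes the `i`-th diagonal entry. -/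
def borelDiag (i : Fin 2) : borel F →* Fˣ where
  toFun g := Units.mk0 ((g : GL (Fin 2) F) i i) (borel_diag_ne_zero g i)
  map_one' := by ext; simp
  map_mul' a b := by
    have ha := mem_borel.1 a.2
    have hb := mem_borel.1 b.2
    ext
    fin_cases i <;> simp [Matrix.mul_apply, Fin.sum_univ_two, ha, hb]

/-- The character `(a, b; 0, c) ↦ lam₁ a * lam₂ c` of `B`. -/
def borelChar (lam₁ lam₂ : Fˣ →* ℂˣ) : borel F →* ℂˣ :=
  lam₁.comp (borelDiag 0) * lam₂.comp (borelDiag 1)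

/-- The representation `V_{lam₁, lam₂}` of `GL₂(F)` induced from the character `(lam₁, lam₂)`
of `B`: the space of all `f : GL₂(F) → ℂ` with `f (b * x) = lam₁ b₁₁ * lam₂ b₂₂ * f x` for `b ∈ B`,
on which `g` acts by `(g f) x = f (x * g)`. -/
abbrev principalSeries (lam₁ lam₂ : Fˣ →* ℂˣ) :
    Representation ℂ (GL (Fin 2) F)
      (coindV (borel F).subtype (charRep (borelChar lam₁ lam₂))) :=
  coind (borel F).subtype (charRep (borelChar lam₁ lam₂))

/-- The one-dimensional representation `ξ ∘ det` of `GL₂(F)`. -/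
abbrev detRep (ξ : Fˣ →* ℂˣ) : Representation ℂ (GL (Fin 2) F) ℂ :=
  charRep (ξ.comp Matrix.GeneralLinearGroup.det)

end Borel

section Steinberg

variable {F : Type*} [Field F] [Fintype F] [DecidableEq F]

/-- The subspace `{f | ∑ g, μ (det g)⁻¹ * f g = 0}` of `V_{μ, μ}`. -/
def steinbergSubmodule (μ : Fˣ →* ℂˣ) :
    Submodule ℂ (coindV (borel F).subtype (charRep (borelChar μ μ))) where
  carrier := {f | ∑ g : GL (Fin 2) F,
    ((μ (Matrix.GeneralLinearGroup.det g))⁻¹ : ℂˣ) * f.1 g = 0}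
  zero_mem' := by simp
  add_mem' := by
    intro f f' hf hf'
    simp only [Set.mem_ofPred_eq] at *
    simp only [Submodule.coe_add, Pi.add_apply, mul_add, Finset.sum_add_distrib, hf, hf',
      add_zero]
  smul_mem' := by
    intro c f hf
    simp only [Set.mem_ofPred_eq] at *
    simp only [Submodule.coe_smul, Pi.smul_apply, smul_eq_mul, mul_left_comm _ c,
      ← Finset.mul_sum, hf, mul_zero]

theorem steinbergSubmodule_le_comap (μ : Fˣ →* ℂˣ) (h : GL (Fin 2) F) :
    steinbergSubmodule μ ≤ (steinbergSubmodule μ).comap (principalSeries μ μ h) := by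
  intro f hf
  change ∑ g : GL (Fin 2) F,
    ((μ (Matrix.GeneralLinearGroup.det g))⁻¹ : ℂˣ) * f.1 (g * h) = 0
  have hf' : ∑ g : GL (Fin 2) F,
    ((μ (Matrix.GeneralLinearGroup.det g))⁻¹ : ℂˣ) * f.1 g = 0 := hf
  have key : ∀ g : GL (Fin 2) F,
      (((μ (Matrix.GeneralLinearGroup.det g))⁻¹ : ℂˣ) : ℂ) * f.1 (g * h) =
        (μ (Matrix.GeneralLinearGroup.det h) : ℂ) *
          ((((μ (Matrix.GeneralLinearGroup.det (g * h)))⁻¹ : ℂˣ) : ℂ) * f.1 (g * h)) := by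
    intro g
    rw [← mul_assoc, ← Units.val_mul]
    congr 2
    simp
  have shift := Equiv.sum_comp (Equiv.mulRight h)
    (fun g => (((μ (Matrix.GeneralLinearGroup.det g))⁻¹ : ℂˣ) : ℂ) * f.1 g)
  simp only [Equiv.coe_mulRight] at shift
  rw [Finset.sum_congr rfl fun g _ => key g, ← Finset.mul_sum, shift, hf', mul_zero]

/-- The space of the representation `W_μ`. -/
def SteinbergSpace (μ : Fˣ →* ℂˣ) : Type _ := steinbergSubmodule μ

instance (μ : Fˣ →* ℂˣ) : AddCommGroup (SteinbergSpace μ) :=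
  inferInstanceAs (AddCommGroup (steinbergSubmodule μ))

instance (μ : Fˣ →* ℂˣ) : Module ℂ (SteinbergSpace μ) :=
  inferInstanceAs (Module ℂ (steinbergSubmodule μ))

/-- The representation `W_μ`: the invariant complement in `V_{μ, μ}` of the line spanned by
the function `μ ∘ det`. -/
def steinberg (μ : Fˣ →* ℂˣ) : Representation ℂ (GL (Fin 2) F) (SteinbergSpace μ) :=
  (principalSeries μ μ).subrepresentation (steinbergSubmodule μ) (steinbergSubmodule_le_comap μ)

end Steinberg

section Complementary

variable {F E : Type*} [Field F] [Field E] [Algebra F E]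

/-- The embedding `Eˣ → GL₂(F)` of a quadratic extension `E` of `F` with basis `b`: an element
is sent to the matrix, in the basis `b`, of the multiplication by it. For `b = (1, √ε)` the
element `x + y √ε` is sent to `(x, ε y; y, x)`. -/
def torusEmb (b : Module.Basis (Fin 2) F E) : Eˣ →* GL (Fin 2) F :=
  Units.map (Algebra.leftMulMatrix b : E →* Matrix (Fin 2) (Fin 2) F)

/-- The representation of `GL₂(F)` induced from the character `ν` of the subgroup `K ≅ Eˣ`. -/
abbrev torusInd (b : Module.Basis (Fin 2) F E) (ν : Eˣ →* ℂˣ) :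
    Representation ℂ (GL (Fin 2) F) (coindV (torusEmb b) (charRep ν)) :=
  coind (torusEmb b) (charRep ν)

/-- The restriction of a character of `Eˣ` to `Fˣ`. -/
abbrev resChar (ν : Eˣ →* ℂˣ) : Fˣ →* ℂˣ :=
  ν.comp (Units.map (algebraMap F E : F →* E))

/-- The character of the virtual representation `W_1 ⊗ V_{α, 1} - V_{α, 1} - Ind_K^G ν`, where
`α` is the restriction of `ν` to `Fˣ` and `1` is the trivial character. -/
def complementaryChar [Fintype F] [DecidableEq F] (b : Module.Basis (Fin 2) F E)
    (ν : Eˣ →* ℂˣ) (g : GL (Fin 2) F) : ℂ :=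
  ((steinberg (1 : Fˣ →* ℂˣ)).tprod (principalSeries (resChar ν) 1)).character g
    - (principalSeries (resChar ν) (1 : Fˣ →* ℂˣ)).character g
    - (torusInd b ν).character g

end Complementary

end

end GL2Rep

/-!
The theorem is a computation with characters, organised so that neither a list of the conjugacy
classes of `G = GL₂(F)` nor their sizes are needed.

*General theory.* Maschke's theorem and Schur's lemma give the orthogonality relations for the
pairing `charInner`. Three consequences carry the proof. A representation whose character has norm
one is irreducible (`isIrreducible_of_charInner_eq_one`). A difference of two characters that has
norm one and nonnegative degree is the character of an irreducible representation
(`exists_isIrreducible_of_charInner_sub_eq_one`): common constituents cancel, and then the norm is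
the sum of the norms of the two characters, so one of them is zero. Irreducible representations
the squares of whose dimensions add up to `|G|` exhaust the irreducible representations
(`mem_of_sum_classDim_sq_eq_card`).

*Frobenius reciprocity.* The character of an induced representation is an explicit sum
(`character_coind`), so a pairing with it is a sum over the inducing subgroup (`charInner_coind`).
The Bruhat decomposition gives the values of the character of `V_{l₁, l₂}` on `B`; averaged over
the unipotent radical they are `l₁ a * l₂ d + l₂ a * l₁ d`. Hence
`⟨V_{l₁, l₂}, V_{l₁', l₂'}⟩ = [(l₁, l₂) = (l₁', l₂')] + [(l₂, l₁) = (l₁', l₂')]`, which decides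
irreducibility and isomorphism for the principal series, and for `W_μ = V_{μ, μ} - ℂ_μ` as well.

*Complementary series.* The virtual character is `θ_ν = (n - 2) V_{α, 1} - Ind ν`, where `n` counts
fixed points on the projective line. Frobenius reciprocity on both terms needs the values of `θ_ν`
only on `B` and on the nonsplit torus, and gives `⟨θ_ν, θ_ν'⟩ = [ν = ν'] + [ν ^ q = ν']`
(`charInner_complementaryChar`). So `θ_ν` is an irreducible character when `ν ^ q ≠ ν`, and the
isomorphisms between the `Y_ν` can be read off.

*Completeness.* The four families have different dimensions, and counting characters shows that
the squares of the dimensions add up to `q (q - 1)² (q + 1) = |G|`.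
-/

namespace GL2Rep

noncomputable section

/-! ### Characters of finite groups -/

section Characters

universe u v w

variable {G : Type u} [Group G]

/-- Every finite-dimensional representation has a copy in coordinates. -/
theorem exists_equiv_pi {V : Type*} [AddCommGroup V] [Module ℂ V] [FiniteDimensional ℂ V]
    (ρ : Representation ℂ G V) {n : ℕ} (hn : Module.finrank ℂ V = n) :
    ∃ σ : Representation ℂ G (Fin n → ℂ), Nonempty (ρ.Equiv σ) := by
  let e : V ≃ₗ[ℂ] (Fin n → ℂ) := (Module.finBasisOfFinrankEq ℂ V hn).equivFun
  let σ : Representation ℂ G (Fin n → ℂ) :=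
    { toFun := fun g => e.conj (ρ g)
      map_one' := by
        rw [map_one]
        exact e.conj_id
      map_mul' := fun g h => by
        rw [map_mul]
        exact e.conj_comp (ρ h) (ρ g) }
  refine ⟨σ, ⟨.mk e fun g => ?_⟩⟩
  ext v i
  simp [σ, LinearEquiv.conj_apply]

theorem character_prod {V W : Type*} [AddCommGroup V] [Module ℂ V] [FiniteDimensional ℂ V]
    [AddCommGroup W] [Module ℂ W] [FiniteDimensional ℂ W]
    (ρ : Representation ℂ G V) (σ : Representation ℂ G W) :
    (ρ.prod σ).character = ρ.character + σ.character := by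
  ext g
  exact LinearMap.trace_prodMap' (ρ g) (σ g)

/-- A function on `G` that is the character of a finite-dimensional representation. -/
def IsCharacter (f : G → ℂ) : Prop :=
  ∃ ρ : FinRep G, ρ.2.character = f

theorem isCharacter_character {V : Type*} [AddCommGroup V] [Module ℂ V] [FiniteDimensional ℂ V]
    (ρ : Representation ℂ G V) : IsCharacter ρ.character := by
  obtain ⟨σ, ⟨e⟩⟩ := exists_equiv_pi ρ rfl
  exact ⟨⟨_, σ⟩, (char_iso e).symm⟩

theorem IsCharacter.add {f g : G → ℂ} (hf : IsCharacter f) (hg : IsCharacter g) :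
    IsCharacter (f + g) := by
  obtain ⟨ρ, rfl⟩ := hf
  obtain ⟨σ, rfl⟩ := hg
  rw [← character_prod]
  exact isCharacter_character _

theorem isCharacter_zero : IsCharacter (0 : G → ℂ) := by
  refine ⟨⟨0, 1⟩, ?_⟩
  ext g
  have : (1 : Representation ℂ G (Fin 0 → ℂ)) g = 0 := Subsingleton.elim _ _
  simp [character, this]

theorem IsCharacter.nsmul {f : G → ℂ} (hf : IsCharacter f) (n : ℕ) : IsCharacter (n • f) := by
  induction n with
  | zero => simpa using isCharacter_zero
  | succ n ih => rw [succ_nsmul]; exact ih.add hf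

theorem IsCharacter.sum {ι : Type*} (s : Finset ι) (f : ι → G → ℂ)
    (hf : ∀ i ∈ s, IsCharacter (f i)) : IsCharacter (∑ i ∈ s, f i) :=
  Finset.sum_induction f IsCharacter (fun _ _ => IsCharacter.add) isCharacter_zero hf

variable [Fintype G]

instance invertibleCardComplex : Invertible (Nat.card G : ℂ) :=
  invertibleOfNonzero (by simp)

/-- The bilinear pairing `|G|⁻¹ ∑ x, f x * g x⁻¹` of functions on `G`. On characters it agrees
with the Hermitian inner product, because `χ x⁻¹` is the complex conjugate of `χ x`. -/
def charInner (f g : G → ℂ) : ℂ :=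
  (Nat.card G : ℂ)⁻¹ * ∑ x : G, f x * g x⁻¹

theorem charInner_comm (f g : G → ℂ) : charInner f g = charInner g f := by
  unfold charInner
  congr 1
  rw [← Equiv.sum_comp (Equiv.inv G)]
  simp [mul_comm]

theorem charInner_add_left (f g h : G → ℂ) :
    charInner (f + g) h = charInner f h + charInner g h := by
  simp [charInner, add_mul, Finset.sum_add_distrib, mul_add]

theorem charInner_sub_left (f g h : G → ℂ) :
    charInner (f - g) h = charInner f h - charInner g h := by
  simp [charInner, sub_mul, Finset.sum_sub_distrib, mul_sub]

theorem charInner_sub_right (f g h : G → ℂ) :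
    charInner h (f - g) = charInner h f - charInner h g := by
  simp [charInner_comm h, charInner_sub_left]

theorem charInner_add_right (f g h : G → ℂ) :
    charInner h (f + g) = charInner h f + charInner h g := by
  simp [charInner_comm h, charInner_add_left]

theorem charInner_nsmul_left (n : ℕ) (f h : G → ℂ) :
    charInner (n • f) h = n * charInner f h := by
  simp [charInner, Finset.mul_sum, mul_left_comm, mul_assoc]

theorem charInner_sum_left {ι : Type*} (s : Finset ι) (f : ι → G → ℂ) (h : G → ℂ) :
    charInner (∑ i ∈ s, f i) h = ∑ i ∈ s, charInner (f i) h := by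
  simp only [charInner, Finset.sum_apply, Finset.sum_mul]
  rw [Finset.sum_comm, Finset.mul_sum]

section Pairing

variable {V : Type v} {W : Type w} [AddCommGroup V] [Module ℂ V] [FiniteDimensional ℂ V]
  [AddCommGroup W] [Module ℂ W] [FiniteDimensional ℂ W]
  (ρ : Representation ℂ G V) (σ : Representation ℂ G W)

theorem charInner_character :
    charInner σ.character ρ.character = Module.finrank ℂ (IntertwiningMap ρ σ) :=
  card_inv_mul_sum_char_mul_char_eq_finrank ρ σ

/-- A representation splits as a direct sum along each of its subrepresentations (Maschke). -/
theorem exists_character_add (p : Subrepresentation ρ) :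
    ∃ q : Subrepresentation ρ,
      ρ.character = p.toRepresentation.character + q.toRepresentation.character ∧
      IsCompl p.toSubmodule q.toSubmodule := by
  obtain ⟨q, hq⟩ := exists_isCompl p
  have hc : IsCompl p.toSubmodule q.toSubmodule := by
    constructor
    · rw [disjoint_iff, ← Subrepresentation.toSubmodule_inf, disjoint_iff.1 hq.1]
      rfl
    · rw [codisjoint_iff, ← Subrepresentation.toSubmodule_sup, codisjoint_iff.1 hq.2]
      rfl
  refine ⟨q, ?_, hc⟩
  rw [← character_prod]
  symm
  refine char_iso (.mk (Submodule.prodEquivOfIsCompl _ _ hc) fun g => ?_)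
  ext v <;> simp <;> rfl

omit [Fintype G] in
/-- A nonzero representation has a nonzero endomorphism, the identity. -/
theorem finrank_intertwiningMap_self_pos [Nontrivial V] :
    0 < Module.finrank ℂ (IntertwiningMap ρ ρ) := by
  have : Nontrivial (IntertwiningMap ρ ρ) := by
    obtain ⟨v, hv⟩ := exists_ne (0 : V)
    exact ⟨1, 0, fun h0 => hv (congrArg (fun f : IntertwiningMap ρ ρ => f v) h0)⟩
  exact Module.finrank_pos

omit [FiniteDimensional ℂ V] [Fintype G] in
theorem nontrivial_subrepresentation [Nontrivial V] : Nontrivial (Subrepresentation ρ) := by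
  refine ⟨⊥, ⊤, fun hbt => ?_⟩
  obtain ⟨v, hv⟩ := exists_ne (0 : V)
  have : v ∈ (⊥ : Subrepresentation ρ).toSubmodule := by
    rw [hbt]
    exact Submodule.mem_top
  exact hv ((Submodule.mem_bot ℂ).1 this)

omit [FiniteDimensional ℂ V] [Fintype G] in
theorem isIrreducible_of_finrank_eq_one (h : Module.finrank ℂ V = 1) : ρ.IsIrreducible := by
  have hs : IsSimpleModule ℂ V := isSimpleModule_iff_finrank_eq_one.2 h
  have := IsSimpleModule.nontrivial ℂ V
  have := nontrivial_subrepresentation ρ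
  refine { eq_bot_or_eq_top := fun p => ?_ }
  rcases eq_bot_or_eq_top p.toSubmodule with h | h
  · exact Or.inl (Subrepresentation.toSubmodule_injective h)
  · exact Or.inr (Subrepresentation.toSubmodule_injective h)

/-- If `ρ = p ⊕ q` with `p` and `q` both nonzero then `⟨ρ, ρ⟩ ≥ ⟨p, p⟩ + ⟨q, q⟩ ≥ 2`, so a
representation whose character has norm one is irreducible. -/
theorem isIrreducible_of_charInner_eq_one
    (h : charInner ρ.character ρ.character = 1) : ρ.IsIrreducible := by
  have hV : Nontrivial V := by
    by_contra hV
    rw [not_nontrivial_iff_subsingleton] at hV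
    have : Subsingleton (IntertwiningMap ρ ρ) :=
      ⟨fun f g => IntertwiningMap.ext (Subsingleton.elim _ _)⟩
    simp [charInner_character, Module.finrank_zero_of_subsingleton] at h
  have := nontrivial_subrepresentation ρ
  refine { eq_bot_or_eq_top := fun p => ?_ }
  obtain ⟨q, hχ, hc⟩ := exists_character_add ρ p
  by_cases hp : p.toSubmodule = ⊥
  · exact Or.inl (Subrepresentation.toSubmodule_injective hp)
  by_cases hq : q.toSubmodule = ⊥
  · right
    refine Subrepresentation.toSubmodule_injective ?_
    rw [hq] at hc
    exact (sup_bot_eq _).symm.trans hc.sup_eq_top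
  exfalso
  have := Submodule.nontrivial_iff_ne_bot.2 hp
  have := Submodule.nontrivial_iff_ne_bot.2 hq
  have hp1 := finrank_intertwiningMap_self_pos p.toRepresentation
  have hq1 := finrank_intertwiningMap_self_pos q.toRepresentation
  rw [hχ] at h
  simp only [charInner_add_left, charInner_add_right, charInner_character] at h
  norm_cast at h
  omega

theorem isIrreducible_iff_charInner_eq_one :
    ρ.IsIrreducible ↔ charInner ρ.character ρ.character = 1 := by
  refine ⟨fun h => ?_, isIrreducible_of_charInner_eq_one ρ⟩
  rw [charInner_character, IsIrreducible.finrank_intertwiningMap_self, Nat.cast_one]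

variable {ρ σ} in
theorem isIrreducible_congr (e : ρ.Equiv σ) : ρ.IsIrreducible ↔ σ.IsIrreducible := by
  rw [isIrreducible_iff_charInner_eq_one, isIrreducible_iff_charInner_eq_one, char_iso e]

variable {ρ σ} in
theorem charInner_eq_zero (hρ : ρ.IsIrreducible) (hσ : σ.IsIrreducible)
    (h : ¬ Nonempty (σ.Equiv ρ)) : charInner ρ.character σ.character = 0 :=
  (char_orthonormal ρ σ).trans (if_neg h)

variable {ρ σ} in
theorem nonempty_equiv_iff_charInner_ne_zero (hρ : ρ.IsIrreducible) (hσ : σ.IsIrreducible) :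
    Nonempty (ρ.Equiv σ) ↔ charInner ρ.character σ.character ≠ 0 := by
  refine ⟨fun ⟨e⟩ => ?_, fun h => ?_⟩
  · rw [char_iso e, (isIrreducible_iff_charInner_eq_one σ).1 hσ]
    exact one_ne_zero
  · by_contra hne
    exact h (charInner_eq_zero hρ hσ fun ⟨e⟩ => hne ⟨e.symm⟩)

omit [FiniteDimensional ℂ V] [Fintype G] in
theorem nontrivial_of_isIrreducible (h : ρ.IsIrreducible) : Nontrivial V := by
  by_contra hV
  rw [not_nontrivial_iff_subsingleton] at hV
  obtain ⟨p, q, hpq⟩ := h.toNontrivial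
  exact hpq (Subrepresentation.toSubmodule_injective (Subsingleton.elim _ _))

omit [FiniteDimensional ℂ V] in
/-- The span of an orbit is a finite-dimensional subrepresentation. -/
theorem finiteDimensional_of_isIrreducible (h : ρ.IsIrreducible) : FiniteDimensional ℂ V := by
  have := nontrivial_of_isIrreducible ρ h
  obtain ⟨v, hv⟩ := exists_ne (0 : V)
  let p : Subrepresentation ρ :=
    { toSubmodule := Submodule.span ℂ (Set.range fun g => ρ g v)
      apply_mem_toSubmodule := fun g w hw => by
        induction hw using Submodule.span_induction with
        | mem x hx =>
          obtain ⟨k, rfl⟩ := hx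
          exact Submodule.subset_span ⟨g * k, by simp⟩
        | zero => simp
        | add x y _ _ hx hy => rw [map_add]; exact add_mem hx hy
        | smul c x _ hx => rw [map_smul]; exact Submodule.smul_mem _ _ hx }
  have hvp : v ∈ p.toSubmodule := Submodule.subset_span ⟨1, by simp⟩
  rcases h.eq_bot_or_eq_top p with hp | hp
  · rw [hp] at hvp
    exact absurd ((Submodule.mem_bot ℂ).1 hvp) hv
  · have hfg : (⊤ : Submodule ℂ V).FG := by
      have : p.toSubmodule = ⊤ := by rw [hp]; rfl
      rw [← this]
      exact Submodule.fg_span (Set.finite_range _)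
    exact ⟨hfg⟩

end Pairing

theorem IsCharacter.exists_charInner_self {f : G → ℂ} (hf : IsCharacter f) :
    ∃ n : ℕ, charInner f f = n ∧ (n = 0 → f = 0) := by
  obtain ⟨ρ, rfl⟩ := hf
  refine ⟨_, charInner_character ρ.2 ρ.2, fun h0 => ?_⟩
  rcases subsingleton_or_nontrivial (Fin ρ.1 → ℂ) with h | h
  · ext g
    have : ρ.2 g = 0 := Subsingleton.elim _ _
    simp [character, this]
  · exact absurd h0 (finrank_intertwiningMap_self_pos ρ.2).ne'

/-- A difference of two characters can be written with characters that have no common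
constituent: a nonzero intertwining map identifies a summand of one representation with a summand
of the other, and this common summand cancels in the difference. -/
theorem exists_sub_eq_sub_charInner_eq_zero {f g : G → ℂ} (hf : IsCharacter f)
    (hg : IsCharacter g) :
    ∃ f' g' : G → ℂ, IsCharacter f' ∧ IsCharacter g' ∧ f - g = f' - g' ∧ charInner f' g' = 0 := by
  obtain ⟨ρ, rfl⟩ := hf
  obtain ⟨σ, rfl⟩ := hg
  obtain ⟨n, hn⟩ : ∃ n, ρ.1 = n := ⟨_, rfl⟩
  induction n using Nat.strong_induction_on generalizing ρ σ with
  | _ n ih =>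
  by_cases h0 : ∀ T : IntertwiningMap ρ.2 σ.2, T = 0
  · have : Subsingleton (IntertwiningMap ρ.2 σ.2) := ⟨fun S T => by rw [h0 S, h0 T]⟩
    refine ⟨_, _, ⟨ρ, rfl⟩, ⟨σ, rfl⟩, rfl, ?_⟩
    rw [charInner_comm, charInner_character, Module.finrank_zero_of_subsingleton, Nat.cast_zero]
  push Not at h0
  obtain ⟨T, hT⟩ := h0
  obtain ⟨q, hq, hc⟩ := exists_character_add ρ.2 T.ker
  obtain ⟨r, hr, -⟩ := exists_character_add σ.2 T.range
  -- The complement `q` of `ker T` is isomorphic to the range of `T`.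
  have hiso : q.toRepresentation.character = T.range.toRepresentation.character := by
    let S : IntertwiningMap q.toRepresentation T.range.toRepresentation :=
      ⟨(T.toLinearMap.comp q.toSubmodule.subtype).codRestrict _ fun x => ⟨x, rfl⟩, fun g => by
        refine LinearMap.ext fun x => Subtype.ext ?_
        exact T.isIntertwining _ _ g (x : Fin ρ.1 → ℂ)⟩
    refine char_iso (S.ofBijective ⟨?_, ?_⟩)
    · rw [injective_iff_map_eq_zero]
      intro x hx
      have hx' : T (x : Fin ρ.1 → ℂ) = 0 := congrArg Subtype.val hx
      have : (x : Fin ρ.1 → ℂ) ∈ T.ker.toSubmodule ⊓ q.toSubmodule := ⟨hx', x.2⟩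
      rw [hc.inf_eq_bot] at this
      exact Subtype.ext ((Submodule.mem_bot ℂ).1 this)
    · rintro ⟨_, v, rfl⟩
      obtain ⟨⟨x, y⟩, rfl⟩ := (Submodule.prodEquivOfIsCompl _ _ hc).surjective v
      refine ⟨y, Subtype.ext ?_⟩
      have hx : T (x : Fin ρ.1 → ℂ) = 0 := x.2
      change T (y : Fin ρ.1 → ℂ) = T ((x : Fin ρ.1 → ℂ) + y)
      rw [map_add, hx, zero_add]
  obtain ⟨ρ', ⟨e⟩⟩ := exists_equiv_pi T.ker.toRepresentation rfl
  obtain ⟨σ', ⟨e'⟩⟩ := exists_equiv_pi r.toRepresentation rfl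
  have hlt : Module.finrank ℂ T.ker.toSubmodule < n := by
    rw [← hn]
    conv_rhs => rw [← Module.finrank_fin_fun ℂ (n := ρ.1)]
    refine Submodule.finrank_lt fun htop => hT (IntertwiningMap.ext ?_)
    exact LinearMap.ker_eq_top.1 htop
  obtain ⟨f', g', hf', hg', heq, hz⟩ := ih _ hlt ⟨_, ρ'⟩ ⟨_, σ'⟩ rfl
  refine ⟨f', g', hf', hg', ?_, hz⟩
  rw [← heq, hq, hr, hiso, char_iso e, char_iso e']
  abel

theorem charInner_self_sub_of_charInner_eq_zero {f g : G → ℂ} (h : charInner f g = 0) :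
    charInner (f - g) (f - g) = charInner f f + charInner g g := by
  rw [charInner_sub_left, charInner_sub_right, charInner_sub_right, h, charInner_comm g f, h]
  ring

theorem IsCharacter.eq_of_charInner_sub_eq_zero {f g : G → ℂ} (hf : IsCharacter f)
    (hg : IsCharacter g) (h : charInner (f - g) (f - g) = 0) : f = g := by
  obtain ⟨f', g', hf', hg', heq, hz⟩ := exists_sub_eq_sub_charInner_eq_zero hf hg
  rw [heq, charInner_self_sub_of_charInner_eq_zero hz] at h
  obtain ⟨m, hm, hm0⟩ := hf'.exists_charInner_self
  obtain ⟨n, hn, hn0⟩ := hg'.exists_charInner_self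
  rw [hm, hn] at h
  norm_cast at h
  rw [← sub_eq_zero, heq, hm0 (by omega), hn0 (by omega), sub_zero]

/-- A virtual character of norm one whose degree is not negative is the character of an
irreducible representation. -/
theorem exists_isIrreducible_of_charInner_sub_eq_one {f g : G → ℂ} (hf : IsCharacter f)
    (hg : IsCharacter g) (h : charInner (f - g) (f - g) = 1) {n : ℕ} (hn : (f - g) 1 = n) :
    ∃ ρ : Representation ℂ G (Fin n → ℂ), ρ.IsIrreducible ∧ ρ.character = f - g := by
  have hnorm := h
  obtain ⟨f', g', hf', hg', heq, hz⟩ := exists_sub_eq_sub_charInner_eq_zero hf hg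
  rw [heq, charInner_self_sub_of_charInner_eq_zero hz] at h
  obtain ⟨a, ha, ha0⟩ := hf'.exists_charInner_self
  obtain ⟨c, hc, hc0⟩ := hg'.exists_charInner_self
  rw [ha, hc] at h
  norm_cast at h
  obtain ⟨ρ, hρ⟩ := hf'
  obtain ⟨σ, hσ⟩ := hg'
  have hρ1 : f' 1 = ρ.1 := by rw [← hρ, char_one, Module.finrank_fin_fun]
  have hσ1 : g' 1 = σ.1 := by rw [← hσ, char_one, Module.finrank_fin_fun]
  have hg0 : g' = 0 := by
    rcases Nat.eq_zero_or_pos c with h0 | h0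
    · exact hc0 h0
    -- Otherwise `f' = 0`, and `-g'` has nonnegative degree, so it has degree zero.
    have hf0 : f' = 0 := ha0 (by omega)
    rw [heq, hf0, Pi.sub_apply, hσ1, Pi.zero_apply, zero_sub] at hn
    have : σ.1 = 0 := by
      have : (σ.1 : ℂ) + n = 0 := by rw [← hn]; ring
      norm_cast at this
      omega
    have : Subsingleton (Fin σ.1 → ℂ) := by rw [this]; infer_instance
    ext x
    have : σ.2 x = 0 := Subsingleton.elim _ _
    rw [← hσ]
    simp [character, this]
  rw [hg0, sub_zero] at heq
  rw [heq, hρ1] at hn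
  norm_cast at hn
  obtain ⟨m, ρ⟩ := ρ
  obtain rfl : m = n := hn
  refine ⟨ρ, isIrreducible_of_charInner_eq_one ρ ?_, by rw [heq]; exact hρ⟩
  rw [show ρ.character = f - g by rw [heq]; exact hρ, hnorm]

end Characters

/-! ### Isomorphism classes of representations -/

section IsoClass

variable {G : Type*} [Group G] {V W : Type*} [AddCommGroup V] [Module ℂ V]
  [FiniteDimensional ℂ V] [AddCommGroup W] [Module ℂ W] [FiniteDimensional ℂ W]
  (ρ : Representation ℂ G V) (σ : Representation ℂ G W)

/-- The isomorphism class of a finite-dimensional representation, as the class of a copy of it in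
coordinates. -/
def isoClass : Quotient (finRepSetoid (G := G)) :=
  Quotient.mk _ ⟨_, (exists_equiv_pi ρ rfl).choose⟩

theorem mk_eq_isoClass_iff (τ : FinRep G) :
    (Quotient.mk _ τ : Quotient (finRepSetoid (G := G))) = isoClass ρ ↔
      Nonempty (τ.2.Equiv ρ) := by
  obtain ⟨e⟩ := (exists_equiv_pi ρ rfl).choose_spec
  refine Quotient.eq.trans ⟨fun ⟨f⟩ => ⟨f.trans e.symm⟩, fun ⟨f⟩ => ⟨f.trans e⟩⟩

theorem isoClass_eq_iff : isoClass ρ = isoClass σ ↔ Nonempty (ρ.Equiv σ) := by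
  obtain ⟨e⟩ := (exists_equiv_pi ρ rfl).choose_spec
  refine (mk_eq_isoClass_iff σ _).trans ⟨fun ⟨f⟩ => ⟨e.trans f⟩, fun ⟨f⟩ => ⟨e.symm.trans f⟩⟩

/-- The character of an isomorphism class of representations. -/
def classCharacter : Quotient (finRepSetoid (G := G)) → G → ℂ :=
  Quotient.lift (fun ρ => ρ.2.character) fun _ _ ⟨e⟩ => char_iso e

/-- The dimension of an isomorphism class of representations. -/
def classDim : Quotient (finRepSetoid (G := G)) → ℕ :=
  Quotient.lift (fun ρ => ρ.1) fun _ _ ⟨e⟩ => by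
    simpa using e.toLinearEquiv.finrank_eq

theorem classDim_isoClass : classDim (isoClass ρ) = Module.finrank ℂ V := rfl

theorem isoClasses_eq_image {ι : Type*} {X : ι → Type*} [∀ i, AddCommGroup (X i)]
    [∀ i, Module ℂ (X i)] [∀ i, FiniteDimensional ℂ (X i)]
    (R : ∀ i, Representation ℂ G (X i)) (s : Set ι) {P : FinRep G → Prop}
    (hP : ∀ τ, P τ ↔ ∃ i ∈ s, Nonempty (τ.2.Equiv (R i))) :
    isoClasses P = (fun i => isoClass (R i)) '' s := by
  ext c
  constructor
  · rintro ⟨τ, hτ, rfl⟩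
    obtain ⟨i, hi, he⟩ := (hP τ).1 hτ
    exact ⟨i, hi, ((mk_eq_isoClass_iff (R i) τ).2 he).symm⟩
  · rintro ⟨i, hi, rfl⟩
    refine ⟨_, (hP _).2 ⟨i, hi, ?_⟩, rfl⟩
    exact (mk_eq_isoClass_iff (R i) _).1 rfl

/-- The size of the image of a map whose fibres on `s` are the orbits of a fixed-point-free
involution. -/
theorem two_mul_ncard_image {ι κ : Type*} (s : Finset ι) (f : ι → κ) (t : ι → ι)
    (hts : ∀ i ∈ s, t i ∈ s) (ht : ∀ i ∈ s, t i ≠ i)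
    (hf : ∀ i ∈ s, ∀ j ∈ s, f i = f j ↔ j = i ∨ j = t i) :
    2 * (f '' (s : Set ι)).ncard = s.card := by
  classical
  rw [← Finset.coe_image, Set.ncard_coe_finset, Finset.card_eq_sum_card_image f s,
    Finset.sum_const_nat (m := 2), mul_comm]
  intro k hk
  obtain ⟨i, hi, rfl⟩ := Finset.mem_image.1 hk
  have : s.filter (fun j => f j = f i) = {i, t i} := by
    ext j
    simp only [Finset.mem_filter, Finset.mem_insert, Finset.mem_singleton]
    constructor
    · rintro ⟨hj, h⟩
      exact (hf i hi j hj).1 h.symm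
    · rintro (rfl | rfl)
      · exact ⟨hi, rfl⟩
      · exact ⟨hts i hi, ((hf i hi _ (hts i hi)).2 (Or.inr rfl)).symm⟩
  rw [this, Finset.card_pair (ht i hi).symm]

variable [Finite G]

/-- If the squares of the dimensions of pairwise non-isomorphic irreducible representations add
up to the order of `G`, then there are no other irreducible representations. For the sum
`∑ dim c • χ_c` and the character of the regular representation have the same inner product
`∑ (dim c) ^ 2 = |G|` with themselves and with each other, so they coincide, and every irreducible
representation occurs in the regular one. -/
theorem mem_of_sum_classDim_sq_eq_card (S : Finset (Quotient (finRepSetoid (G := G))))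
    (hS : ∀ c ∈ S, c ∈ isoClasses fun ρ : FinRep G => ρ.2.IsIrreducible)
    (hcard : ∑ c ∈ S, classDim c ^ 2 = Nat.card G)
    (ρ : Representation ℂ G V) (hρ : ρ.IsIrreducible) : isoClass ρ ∈ S := by
  classical
  have := Fintype.ofFinite G
  by_contra hmem
  let reg := leftRegular ℂ G
  have : FiniteDimensional ℂ (MonoidAlgebra ℂ G) := inferInstance
  have hreg : ∀ τ : FinRep G, charInner τ.2.character reg.character = τ.1 := fun τ => by
    rw [charInner_character, (leftRegularMapEquiv τ.2).finrank_eq, Module.finrank_fin_fun]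
  have hregρ : charInner ρ.character reg.character = Module.finrank ℂ V := by
    rw [charInner_character, (leftRegularMapEquiv ρ).finrank_eq]
  have hregreg : charInner reg.character reg.character = Nat.card G := by
    rw [charInner_character, (leftRegularMapEquiv reg).finrank_eq,
      (MonoidAlgebra.coeffLinearEquiv ℂ).finrank_eq, Module.finrank_finsupp_self,
      Nat.card_eq_fintype_card]
  let Θ : G → ℂ := ∑ c ∈ S, classDim c • classCharacter c
  have hΘ : IsCharacter Θ := IsCharacter.sum _ _ fun c _ => by
    induction c using Quotient.inductionOn with
    | h τ => exact (isCharacter_character τ.2).nsmul _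
  have hΘreg : charInner Θ reg.character = Nat.card G := by
    rw [charInner_sum_left, ← hcard, Nat.cast_sum]
    refine Finset.sum_congr rfl fun c _ => ?_
    induction c using Quotient.inductionOn with
    | h τ =>
      rw [charInner_nsmul_left]
      exact (congrArg _ (hreg τ)).trans (by rw [sq, Nat.cast_mul]; rfl)
  have horth : ∀ c ∈ S, ∀ d ∈ S,
      charInner (classCharacter c) (classCharacter d) = if c = d then 1 else 0 := by
    intro c hc d hd
    obtain ⟨σ, hσ, rfl⟩ := hS c hc
    obtain ⟨τ, hτ, rfl⟩ := hS d hd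
    split_ifs with h
    · rw [← h]
      exact (isIrreducible_iff_charInner_eq_one σ.2).1 hσ
    · exact charInner_eq_zero hσ hτ fun he => h (Quotient.sound (Setoid.symm he))
  have hΘΘ : charInner Θ Θ = Nat.card G := by
    rw [charInner_sum_left, ← hcard, Nat.cast_sum]
    refine Finset.sum_congr rfl fun c hc => ?_
    rw [charInner_nsmul_left, charInner_comm, charInner_sum_left]
    rw [Finset.sum_congr rfl fun d hd => by
      rw [charInner_nsmul_left, horth d hd c hc, mul_ite, mul_one, mul_zero]]
    rw [Finset.sum_ite_eq', if_pos hc, sq, Nat.cast_mul]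
  have heq : Θ = reg.character := by
    refine hΘ.eq_of_charInner_sub_eq_zero (isCharacter_character reg) ?_
    rw [charInner_sub_left, charInner_sub_right, charInner_sub_right, hΘΘ, hΘreg, hregreg,
      charInner_comm, hΘreg]
    ring
  have hzero : charInner Θ ρ.character = 0 := by
    rw [charInner_sum_left]
    refine Finset.sum_eq_zero fun c hc => ?_
    rw [charInner_nsmul_left]
    obtain ⟨σ, hσ, rfl⟩ := hS c hc
    refine mul_eq_zero_of_right _ (charInner_eq_zero hσ hρ fun ⟨e⟩ => hmem ?_)
    rw [← (mk_eq_isoClass_iff ρ σ).2 ⟨e.symm⟩]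
    exact hc
  rw [heq, charInner_comm, hregρ] at hzero
  have := nontrivial_of_isIrreducible ρ hρ
  exact Module.finrank_pos.ne' (Nat.cast_eq_zero.1 hzero)

end IsoClass

/-! ### Characters of induced representations -/

section Induced

variable {G H : Type*} [Group G] [Group H] [Fintype G] [Fintype H]

/-- The character of a representation induced from a one-dimensional one. The operator
`f ↦ |H|⁻¹ ∑ h, χ h⁻¹ * f (φ h * x * g)` on all functions on `G` has image in the induced
representation and acts there as `g`, so the character is the trace of this operator. -/
theorem character_coind [DecidableEq G] (φ : H →* G) (χ : H →* ℂˣ) (g : G) :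
    (coind φ (charRep χ)).character g =
      (Nat.card H : ℂ)⁻¹ * ∑ x : G, ∑ h : H, if φ h = x * g * x⁻¹ then (χ h : ℂ) else 0 := by
  let T : (G → ℂ) →ₗ[ℂ] (G → ℂ) :=
    { toFun := fun f x => (Nat.card H : ℂ)⁻¹ * ∑ h : H, (χ h⁻¹ : ℂ) * f (φ h * x * g)
      map_add' := fun f f' => by
        ext x
        simp [mul_add, Finset.sum_add_distrib]
      map_smul' := fun c f => by
        ext x
        simp only [Pi.smul_apply, smul_eq_mul, RingHom.id_apply, Finset.mul_sum]
        exact Finset.sum_congr rfl fun h _ => by ring }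
  have hTmem : ∀ f, T f ∈ coindV φ (charRep χ) := by
    intro f k x
    change (Nat.card H : ℂ)⁻¹ * ∑ h : H, (χ h⁻¹ : ℂ) * f (φ h * (φ k * x) * g) =
      (χ k : ℂ) * ((Nat.card H : ℂ)⁻¹ * ∑ h : H, (χ h⁻¹ : ℂ) * f (φ h * x * g))
    rw [mul_left_comm, ← Equiv.sum_comp (Equiv.mulRight k) fun h => (χ h⁻¹ : ℂ) * f (φ h * x * g),
      Finset.mul_sum _ _ (χ k : ℂ)]
    congr 1
    refine Finset.sum_congr rfl fun h _ => ?_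
    rw [← mul_assoc (χ k : ℂ), ← Units.val_mul, ← map_mul]
    simp [mul_assoc]
  have hTcoind : ∀ f ∈ coindV φ (charRep χ), ∀ x, T f x = f (x * g) := by
    intro f hf x
    change (Nat.card H : ℂ)⁻¹ * ∑ h : H, (χ h⁻¹ : ℂ) * f (φ h * x * g) = _
    have : ∀ h : H, (χ h⁻¹ : ℂ) * f (φ h * x * g) = f (x * g) := fun h => by
      rw [mul_assoc, hf h (x * g), charRep_apply, ← mul_assoc, ← Units.val_mul, ← map_mul]
      simp
    rw [Finset.sum_congr rfl fun h _ => this h]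
    simp
  have htr : LinearMap.trace ℂ _ T = (coind φ (charRep χ)).character g := by
    rw [← LinearMap.trace_restrict_eq_of_forall_mem _ T hTmem]
    unfold character
    congr 1
    ext f x
    exact hTcoind f.1 f.2 x
  rw [← htr, LinearMap.trace_eq_matrix_trace ℂ (Pi.basisFun ℂ G), Matrix.trace, Finset.mul_sum]
  refine Finset.sum_congr rfl fun x _ => ?_
  rw [Matrix.diag_apply, LinearMap.toMatrix_apply, Pi.basisFun_apply, Pi.basisFun_repr]
  change (Nat.card H : ℂ)⁻¹ * ∑ h : H, (χ h⁻¹ : ℂ) * (Pi.single x 1 : G → ℂ) (φ h * x * g) = _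
  congr 1
  rw [← Equiv.sum_comp (Equiv.inv H)]
  refine Finset.sum_congr rfl fun h _ => ?_
  have : (φ h)⁻¹ * x * g = x ↔ φ h = x * g * x⁻¹ := by
    rw [mul_assoc, inv_mul_eq_iff_eq_mul, eq_mul_inv_iff_mul_eq]
    exact eq_comm
  simp [Pi.single_apply, this]

/-- Frobenius reciprocity for characters. -/
theorem charInner_coind (φ : H →* G) (χ : H →* ℂˣ) (f : G → ℂ)
    (hf : ∀ x g, f (x * g * x⁻¹) = f g) :
    charInner f (coind φ (charRep χ)).character =
      (Nat.card H : ℂ)⁻¹ * ∑ h : H, f (φ h) * (χ h⁻¹ : ℂ) := by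
  classical
  have hG : (Nat.card G : ℂ) ≠ 0 := by simp
  have key : ∑ g : G, f g * ∑ x : G, ∑ h : H, (if φ h = x * g⁻¹ * x⁻¹ then (χ h : ℂ) else 0) =
      Nat.card G * ∑ h : H, f (φ h) * (χ h⁻¹ : ℂ) := by
    simp only [Finset.mul_sum]
    rw [Finset.sum_comm]
    have hx : ∀ x : G, ∑ g : G, ∑ h : H, f g * (if φ h = x * g⁻¹ * x⁻¹ then (χ h : ℂ) else 0) =
        ∑ h : H, f (φ h) * (χ h⁻¹ : ℂ) := by
      intro x
      rw [Finset.sum_comm, ← Equiv.sum_comp (Equiv.inv H)]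
      refine Finset.sum_congr rfl fun h _ => ?_
      rw [Finset.sum_eq_single (x⁻¹ * φ h * x)]
      · rw [if_pos (by simp [mul_assoc])]
        congr 1
        simpa using hf x⁻¹ (φ h)
      · intro g _ hg
        rw [if_neg, mul_zero]
        intro h'
        apply hg
        have : φ h = x * g * x⁻¹ := by
          have := congrArg (·⁻¹) h'
          simpa [mul_assoc] using this
        rw [this]
        group
      · simp
    rw [Finset.sum_congr rfl fun x _ => hx x]
    simp [Finset.mul_sum]
  simp only [charInner, character_coind]
  simp only [mul_left_comm _ (Nat.card H : ℂ)⁻¹]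
  rw [← Finset.mul_sum, key]
  field_simp

end Induced

/-! ### The Borel subgroup and the principal series characters -/

section BorelSums

variable {F : Type*} [Field F]

/-- The upper triangular matrix `(a, b; 0, d)`. -/
def upper (a d : Fˣ) (b : F) : GL (Fin 2) F :=
  Matrix.GeneralLinearGroup.mkOfDetNeZero !![(a : F), b; 0, (d : F)] (by simp)

/-- The product of the Weyl element `(0, 1; 1, 0)` with the unipotent matrix `(1, t; 0, 1)`. -/
def weylMulUnipotent (t : F) : GL (Fin 2) F :=
  Matrix.GeneralLinearGroup.mkOfDetNeZero !![0, 1; 1, t] (by simp)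

theorem coe_upper (a d : Fˣ) (b : F) :
    (upper a d b : Matrix (Fin 2) (Fin 2) F) = !![(a : F), b; 0, (d : F)] := rfl

theorem coe_weylMulUnipotent (t : F) :
    (weylMulUnipotent t : Matrix (Fin 2) (Fin 2) F) = !![0, 1; 1, t] := rfl

theorem upper_mem_borel (a d : Fˣ) (b : F) : upper a d b ∈ borel F := by
  rw [mem_borel, coe_upper]
  simp

theorem det_upper (a d : Fˣ) (b : F) :
    Matrix.GeneralLinearGroup.det (upper a d b) = a * d := by
  ext
  simp [coe_upper]

theorem upper_mul (a d a' d' : Fˣ) (b b' : F) :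
    upper a d b * upper a' d' b' = upper (a * a') (d * d') (a * b' + b * d') := by
  ext i j
  fin_cases i <;> fin_cases j <;> simp [coe_upper, Matrix.mul_apply, Fin.sum_univ_two]

theorem upper_inv (a d : Fˣ) (b : F) :
    (upper a d b)⁻¹ = upper a⁻¹ d⁻¹ (-(a⁻¹ * b * d⁻¹ : F)) := by
  rw [inv_eq_iff_mul_eq_one, upper_mul]
  ext i j
  fin_cases i <;> fin_cases j <;> simp [coe_upper]
  rw [← mul_assoc, ← mul_assoc, mul_inv_cancel₀ a.ne_zero, one_mul, neg_add_cancel]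

/-- Coordinates on the Borel subgroup. -/
def borelEquiv : (Fˣ × Fˣ × F) ≃ borel F where
  toFun p := ⟨upper p.1 p.2.1 p.2.2, upper_mem_borel _ _ _⟩
  invFun g := ⟨borelDiag 0 g, borelDiag 1 g, (g : GL (Fin 2) F) 0 1⟩
  left_inv p := by
    obtain ⟨a, d, b⟩ := p
    refine Prod.ext (Units.ext ?_) (Prod.ext (Units.ext ?_) ?_) <;>
      simp [borelDiag, coe_upper]
  right_inv g := by
    have := mem_borel.1 g.2
    ext i j
    fin_cases i <;> fin_cases j <;> simp [borelDiag, coe_upper, this]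

theorem borelChar_upper (l₁ l₂ : Fˣ →* ℂˣ) (a d : Fˣ) (b : F) :
    borelChar l₁ l₂ ⟨upper a d b, upper_mem_borel a d b⟩ = l₁ a * l₂ d := by
  have h0 : borelDiag 0 ⟨upper a d b, upper_mem_borel a d b⟩ = a := Units.ext (by
    simp [borelDiag, coe_upper])
  have h1 : borelDiag 1 ⟨upper a d b, upper_mem_borel a d b⟩ = d := Units.ext (by
    simp [borelDiag, coe_upper])
  simp [borelChar, h0, h1]

/-- The Bruhat decomposition `G = B ⊔ B w U` as a set of coset representatives. -/
def bruhatEquiv : (borel F × Option F) ≃ GL (Fin 2) F :=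
  Equiv.ofBijective
    (fun p => (p.1 : GL (Fin 2) F) * p.2.elim 1 weylMulUnipotent) <| by
    constructor
    · have hw : ∀ (b : borel F) (t : F), ((b : GL (Fin 2) F) * weylMulUnipotent t) 1 0 =
          (b : GL (Fin 2) F) 1 1 ∧ ((b : GL (Fin 2) F) * weylMulUnipotent t) 1 1 =
          (b : GL (Fin 2) F) 1 1 * t := fun b t => by
        have := mem_borel.1 b.2
        simp [coe_weylMulUnipotent, Matrix.mul_apply, Fin.sum_univ_two, this]
      rintro ⟨b, s⟩ ⟨b', s'⟩ h
      have key : s = s' := by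
        cases s with
        | none =>
          cases s' with
          | none => rfl
          | some t' =>
            have h' := congrArg (fun g : GL (Fin 2) F => g 1 0) h
            simp only [Option.elim_none, Option.elim_some, mul_one, (hw _ _).1,
              mem_borel.1 b.2] at h'
            exact absurd h'.symm (borel_diag_ne_zero b' 1)
        | some t =>
          cases s' with
          | none =>
            have h' := congrArg (fun g : GL (Fin 2) F => g 1 0) h
            simp only [Option.elim_none, Option.elim_some, mul_one, (hw _ _).1,
              mem_borel.1 b'.2] at h'
            exact absurd h' (borel_diag_ne_zero b 1)
          | some t' =>
            have h0 := congrArg (fun g : GL (Fin 2) F => g 1 0) h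
            have h1 := congrArg (fun g : GL (Fin 2) F => g 1 1) h
            simp only [Option.elim_some, (hw _ _).1, (hw _ _).2] at h0 h1
            rw [h0] at h1
            rw [mul_left_cancel₀ (borel_diag_ne_zero b' 1) h1]
      subst key
      exact Prod.ext (Subtype.ext (mul_right_cancel h)) rfl
    · intro x
      by_cases hx : x 1 0 = 0
      · exact ⟨(⟨x, hx⟩, none), by simp⟩
      · refine ⟨(⟨x * (weylMulUnipotent (x 1 1 / x 1 0))⁻¹, ?_⟩,
          some (x 1 1 / x 1 0)), by simp⟩
        rw [mem_borel, Matrix.GeneralLinearGroup.coe_mul, Matrix.coe_units_inv,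
          Matrix.inv_def, Matrix.adjugate_fin_two]
        simp [coe_weylMulUnipotent, Matrix.mul_apply, Fin.sum_univ_two]
        field_simp
        ring

variable [Fintype F] [DecidableEq F]

instance fintypeBorel : Fintype (borel F) := Fintype.ofEquiv _ borelEquiv

theorem sum_borel {M : Type*} [AddCommMonoid M] (f : borel F → M) :
    ∑ b, f b = ∑ a : Fˣ, ∑ d : Fˣ, ∑ b : F, f ⟨upper a d b, upper_mem_borel a d b⟩ := by
  rw [← borelEquiv.sum_comp, Fintype.sum_prod_type]
  refine Finset.sum_congr rfl fun a _ => ?_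
  rw [Fintype.sum_prod_type]
  rfl

theorem card_borel :
    Nat.card (borel F) = Fintype.card F * (Fintype.card F - 1) ^ 2 := by
  rw [← Nat.card_congr borelEquiv, Nat.card_prod, Nat.card_prod, Nat.card_eq_fintype_card,
    Nat.card_eq_fintype_card, Fintype.card_units]
  ring

omit [DecidableEq F] in
theorem card_GL_two :
    Nat.card (GL (Fin 2) F) = Nat.card (borel F) * (Fintype.card F + 1) := by
  rw [← Nat.card_congr bruhatEquiv, Nat.card_prod, Finite.card_option,
    Nat.card_eq_fintype_card (α := F)]

/-- The sum over `G` of a function on `B \ G`. -/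
theorem sum_of_borel_mul (f : GL (Fin 2) F → ℂ) (hf : ∀ (b : borel F) x, f (b * x) = f x) :
    ∑ x, f x = Nat.card (borel F) * (f 1 + ∑ t, f (weylMulUnipotent t)) := by
  rw [← bruhatEquiv.sum_comp, Fintype.sum_prod_type]
  have : ∀ b : borel F, ∑ s : Option F, f (bruhatEquiv (b, s)) =
      f 1 + ∑ t, f (weylMulUnipotent t) := fun b => by
    rw [Fintype.sum_option]
    congr 1
    · exact hf b 1
    · exact Finset.sum_congr rfl fun t _ => hf b _
  simp [this, mul_add]

/-- The fixed-point formula on `B \ G`, that is, on the projective line. -/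
theorem character_principalSeries (l₁ l₂ : Fˣ →* ℂˣ) (a d : Fˣ) (b : F) :
    (principalSeries l₁ l₂).character (upper a d b) =
      l₁ a * l₂ d + ∑ t : F, if b = t * (a - d) then (l₁ d * l₂ a : ℂ) else 0 := by
  have hB : (Nat.card (borel F) : ℂ) ≠ 0 := by simp
  set g := upper a d b
  have hin : ∀ (x : GL (Fin 2) F) (a' d' : Fˣ) (b' : F), x * g = upper a' d' b' * x →
      ∑ h : borel F, (if (borel F).subtype h = x * g * x⁻¹ then
        (borelChar l₁ l₂ h : ℂ) else 0) = l₁ a' * l₂ d' := by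
    intro x a' d' b' hx
    rw [Finset.sum_eq_single ⟨upper a' d' b', upper_mem_borel a' d' b'⟩]
    · rw [if_pos (by rw [hx]; simp), borelChar_upper]
      simp
    · intro h _ hne
      rw [if_neg]
      intro h'
      apply hne
      apply Subtype.ext
      rw [hx] at h'
      simpa using h'
    · simp
  rw [character_coind, sum_of_borel_mul, inv_mul_cancel_left₀ hB]
  · congr 1
    · exact hin 1 a d b (by simp [g])
    · refine Finset.sum_congr rfl fun t _ => ?_
      have hconj : ((weylMulUnipotent t * g : GL (Fin 2) F) : Matrix (Fin 2) (Fin 2) F) =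
          !![(d : F), 0; b - t * (a - d), (a : F)] * weylMulUnipotent t := by
        rw [Matrix.GeneralLinearGroup.coe_mul, coe_weylMulUnipotent, coe_upper]
        ext i j
        fin_cases i <;> fin_cases j <;> simp [Matrix.mul_apply, Fin.sum_univ_two]
        ring
      split_ifs with ht
      · refine hin _ d a 0 (Units.ext (hconj.trans ?_))
        rw [Matrix.GeneralLinearGroup.coe_mul, coe_upper, ht, sub_self]
      · refine Finset.sum_eq_zero fun h _ => if_neg fun h' => ht ?_
        have h1 : h * weylMulUnipotent t = weylMulUnipotent t * g := by
          rw [← eq_mul_inv_iff_mul_eq]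
          exact h'
        have h2 := congrArg (fun g : GL (Fin 2) F => (g : Matrix (Fin 2) (Fin 2) F)) h1
        simp only [hconj] at h2
        rw [Matrix.GeneralLinearGroup.coe_mul] at h2
        have h3 := (Matrix.mul_left_inj_of_invertible
          (weylMulUnipotent t : Matrix (Fin 2) (Fin 2) F)).1 h2
        have h4 := congrFun (congrFun h3 1) 0
        have h5 := mem_borel.1 h.2
        rw [h5] at h4
        simpa [sub_eq_zero] using h4.symm
  · intro c x
    rw [← Equiv.sum_comp (MulAut.conj c).toEquiv]
    refine Finset.sum_congr rfl fun h _ => ?_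
    have hχ : borelChar l₁ l₂ ((MulAut.conj c).toEquiv h) = borelChar l₁ l₂ h := by
      simp
    rw [hχ]
    congr 1
    simp only [MulEquiv.toEquiv_eq_coe, MulEquiv.coe_toEquiv, MulAut.conj_apply, map_mul, map_inv,
      Subgroup.subtype_apply, mul_inv_rev, eq_iff_iff]
    rw [← mul_assoc, mul_left_inj, mul_assoc, mul_assoc, mul_right_inj, mul_assoc]

end BorelSums

/-! ### The one-dimensional, principal series and Steinberg representations -/

section Borelian

variable {F : Type*} [Field F] [Fintype F] [DecidableEq F]

theorem sum_coe_monoidHom {A : Type*} [Group A] [Fintype A] (χ : A →* ℂˣ) [Decidable (χ = 1)] :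
    ∑ a, (χ a : ℂ) = if χ = 1 then (Fintype.card A : ℂ) else 0 := by
  have h := sum_hom_units ((Units.coeHom ℂ).comp χ)
  have : (Units.coeHom ℂ).comp χ = 1 ↔ χ = 1 := by
    refine ⟨fun h => ?_, fun h => by rw [h]; rfl⟩
    ext a
    exact DFunLike.congr_fun h a
  classical
  simpa [this] using h

open Classical in
theorem sum_mul_inv_monoidHom {A : Type*} [Group A] [Fintype A] (χ ψ : A →* ℂˣ) :
    ∑ a, (χ a : ℂ) * (ψ a : ℂ)⁻¹ = if χ = ψ then (Fintype.card A : ℂ) else 0 := by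
  have h := sum_coe_monoidHom (χ / ψ)
  simp only [MonoidHom.div_apply, div_eq_mul_inv, Units.val_mul, Units.val_inv_eq_inv_val] at h
  rw [h]
  refine if_congr ⟨fun h => ?_, fun h => ?_⟩ rfl rfl
  · ext a
    exact congrArg Units.val (div_eq_one.1 (DFunLike.congr_fun h a))
  · ext a
    exact congrArg Units.val (div_eq_one.2 (DFunLike.congr_fun h a))

theorem character_charRep {G : Type*} [Group G] (χ : G →* ℂˣ) (g : G) :
    (charRep χ).character g = χ g := by
  have : charRep χ g = (χ g : ℂ) • LinearMap.id := by
    ext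
    simp
  simp [character, this]

theorem charInner_charRep_self {G : Type*} [Group G] [Fintype G] (χ : G →* ℂˣ) :
    charInner (charRep χ).character (charRep χ).character = 1 := by
  simp [charInner, character_charRep]

theorem isIrreducible_detRep (ξ : Fˣ →* ℂˣ) : (detRep ξ).IsIrreducible :=
  isIrreducible_of_charInner_eq_one _ (charInner_charRep_self _)

omit [Fintype F] [DecidableEq F] in
theorem detRep_equiv_iff (ξ ξ' : Fˣ →* ℂˣ) :
    Nonempty ((detRep ξ).Equiv (detRep ξ')) ↔ ξ = ξ' := by
  refine ⟨fun ⟨e⟩ => ?_, fun h => h ▸ ⟨.refl _⟩⟩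
  ext a
  have h := congrFun (char_iso e) (upper a 1 0)
  simpa [character_charRep, det_upper] using h

theorem card_units_complex : (Fintype.card Fˣ : ℂ) = Fintype.card F - 1 := by
  rw [Fintype.card_units, Nat.cast_sub Fintype.card_pos, Nat.cast_one]

theorem card_sub_one_ne_zero : (Fintype.card F - 1 : ℂ) ≠ 0 := by
  rw [← card_units_complex]
  simp

theorem card_borel_complex :
    (Nat.card (borel F) : ℂ) = Fintype.card F * (Fintype.card F - 1 : ℂ) ^ 2 := by
  rw [card_borel, Nat.cast_mul, Nat.cast_pow, Nat.cast_sub Fintype.card_pos, Nat.cast_one]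

/-- Frobenius reciprocity for the Borel subgroup, in coordinates. -/
theorem charInner_principalSeries (l₁ l₂ : Fˣ →* ℂˣ) (f : GL (Fin 2) F → ℂ)
    (hf : ∀ x g, f (x * g * x⁻¹) = f g) :
    charInner f (principalSeries l₁ l₂).character =
      (Nat.card (borel F) : ℂ)⁻¹ *
        ∑ a : Fˣ, ∑ d : Fˣ, (∑ b : F, f (upper a d b)) * ((l₁ a : ℂ)⁻¹ * (l₂ d : ℂ)⁻¹) := by
  rw [charInner_coind _ _ f hf, sum_borel]
  congr 1
  refine Finset.sum_congr rfl fun a _ => Finset.sum_congr rfl fun d _ => ?_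
  rw [Finset.sum_mul]
  refine Finset.sum_congr rfl fun b _ => ?_
  rw [map_inv, borelChar_upper]
  simp [mul_comm]

/-- Summed over the unipotent radical, the character becomes symmetric in the two characters of
`Fˣ`, with the same formula for all `a` and `d`. -/
theorem sum_character_principalSeries (l₁ l₂ : Fˣ →* ℂˣ) (a d : Fˣ) :
    ∑ b : F, (principalSeries l₁ l₂).character (upper a d b) =
      Fintype.card F * (l₁ a * l₂ d + l₂ a * l₁ d) := by
  simp only [character_principalSeries, Finset.sum_add_distrib]
  rw [Finset.sum_comm]
  simp
  ring

open Classical in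
theorem charInner_principalSeries_principalSeries (l₁ l₂ l₁' l₂' : Fˣ →* ℂˣ) :
    charInner (principalSeries l₁ l₂).character (principalSeries l₁' l₂').character =
      (if l₁ = l₁' ∧ l₂ = l₂' then 1 else 0) + (if l₂ = l₁' ∧ l₁ = l₂' then 1 else 0) := by
  have hq : (Fintype.card F : ℂ) ≠ 0 := by simp
  have hq1 := card_sub_one_ne_zero (F := F)
  rw [charInner_principalSeries _ _ _ fun x g => char_conj _ g x]
  simp only [sum_character_principalSeries]
  have h : ∀ a d : Fˣ, (Fintype.card F : ℂ) * (l₁ a * l₂ d + l₂ a * l₁ d) *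
      ((l₁' a : ℂ)⁻¹ * (l₂' d : ℂ)⁻¹) = Fintype.card F *
        ((l₁ a * (l₁' a : ℂ)⁻¹) * (l₂ d * (l₂' d : ℂ)⁻¹) +
          (l₂ a * (l₁' a : ℂ)⁻¹) * (l₁ d * (l₂' d : ℂ)⁻¹)) := fun a d => by ring
  simp only [h, ← Finset.mul_sum, Finset.sum_add_distrib, ← Finset.sum_mul,
    sum_mul_inv_monoidHom]
  rw [card_borel_complex, card_units_complex]
  split_ifs <;> simp_all <;> field_simp

open Classical in
theorem charInner_detRep_principalSeries (ξ μ : Fˣ →* ℂˣ) :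
    charInner (detRep ξ).character (principalSeries μ μ).character = if ξ = μ then 1 else 0 := by
  have hq : (Fintype.card F : ℂ) ≠ 0 := by simp
  have hq1 := card_sub_one_ne_zero (F := F)
  rw [charInner_principalSeries _ _ _ fun x g => char_conj _ g x]
  have h : ∀ a d : Fˣ, (∑ b : F, (detRep ξ).character (upper a d b)) *
      ((μ a : ℂ)⁻¹ * (μ d : ℂ)⁻¹) = Fintype.card F *
        ((ξ a * (μ a : ℂ)⁻¹) * (ξ d * (μ d : ℂ)⁻¹)) := fun a d => by
    simp [character_charRep, det_upper]
    ring
  simp only [h, ← Finset.mul_sum, ← Finset.sum_mul, sum_mul_inv_monoidHom]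
  rw [card_borel_complex, card_units_complex]
  split_ifs <;> field_simp
  simp

theorem finrank_principalSeries (l₁ l₂ : Fˣ →* ℂˣ) :
    Module.finrank ℂ (coindV (borel F).subtype (charRep (borelChar l₁ l₂))) =
      Fintype.card F + 1 := by
  have h := char_one (principalSeries l₁ l₂)
  have h1 : (1 : GL (Fin 2) F) = upper 1 1 0 := by
    ext i j
    fin_cases i <;> fin_cases j <;> simp [coe_upper]
  rw [h1, character_principalSeries] at h
  simp only [Units.val_one, sub_self, mul_zero, if_true] at h
  have : ((Module.finrank ℂ (coindV (borel F).subtype (charRep (borelChar l₁ l₂))) : ℕ) : ℂ) =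
      (Fintype.card F + 1 : ℕ) := by
    rw [← h]
    simp
    ring
  exact_mod_cast this

theorem isIrreducible_principalSeries {l₁ l₂ : Fˣ →* ℂˣ} (h : l₁ ≠ l₂) :
    (principalSeries l₁ l₂).IsIrreducible := by
  refine isIrreducible_of_charInner_eq_one _ ?_
  rw [charInner_principalSeries_principalSeries]
  simp [h]

theorem principalSeries_equiv_iff {l₁ l₂ l₁' l₂' : Fˣ →* ℂˣ} (h : l₁ ≠ l₂) (h' : l₁' ≠ l₂') :
    Nonempty ((principalSeries l₁ l₂).Equiv (principalSeries l₁' l₂')) ↔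
      (l₁ = l₁' ∧ l₂ = l₂') ∨ (l₁ = l₂' ∧ l₂ = l₁') := by
  rw [nonempty_equiv_iff_charInner_ne_zero (isIrreducible_principalSeries h)
    (isIrreducible_principalSeries h'), charInner_principalSeries_principalSeries]
  by_cases h1 : l₁ = l₁' <;> by_cases h2 : l₂ = l₂' <;> by_cases h3 : l₁ = l₂' <;>
    by_cases h4 : l₂ = l₁' <;> simp_all

instance finiteDimensional_steinbergSpace (μ : Fˣ →* ℂˣ) :
    FiniteDimensional ℂ (SteinbergSpace μ) :=
  inferInstanceAs (FiniteDimensional ℂ (steinbergSubmodule μ))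

omit [Fintype F] [DecidableEq F] in
theorem borelChar_self (μ : Fˣ →* ℂˣ) (g : borel F) :
    borelChar μ μ g = μ (Matrix.GeneralLinearGroup.det (g : GL (Fin 2) F)) := by
  obtain ⟨⟨a, d, b⟩, rfl⟩ := borelEquiv.surjective g
  have := borelChar_upper μ μ a d b
  change borelChar μ μ ⟨upper a d b, _⟩ = μ (Matrix.GeneralLinearGroup.det (upper a d b))
  rw [this, det_upper, map_mul]

/-- The function `μ ∘ det`, which spans the invariant complement of `W_μ` in `V_{μ, μ}`. -/
def detFun (μ : Fˣ →* ℂˣ) : coindV (borel F).subtype (charRep (borelChar μ μ)) :=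
  ⟨fun g => μ (Matrix.GeneralLinearGroup.det g), fun b x => by
    rw [charRep_apply, borelChar_self]
    simp⟩

omit [Fintype F] [DecidableEq F] in
theorem principalSeries_detFun (μ : Fˣ →* ℂˣ) (g : GL (Fin 2) F) :
    principalSeries μ μ g (detFun μ) = (μ (Matrix.GeneralLinearGroup.det g) : ℂ) • detFun μ := by
  refine Subtype.ext (funext fun x => ?_)
  change ((μ (Matrix.GeneralLinearGroup.det (x * g)) : ℂˣ) : ℂ) =
    (μ (Matrix.GeneralLinearGroup.det g) : ℂ) * (μ (Matrix.GeneralLinearGroup.det x) : ℂ)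
  simp [mul_comm]

theorem bijective_smul_detFun_add (μ : Fˣ →* ℂˣ) :
    Function.Bijective (fun p : ℂ × SteinbergSpace μ =>
      p.1 • detFun μ + (show steinbergSubmodule μ from p.2).1) := by
  -- the functional whose kernel is `W_μ`
  let ℓ : coindV (borel F).subtype (charRep (borelChar μ μ)) →ₗ[ℂ] ℂ :=
    { toFun := fun f => ∑ g : GL (Fin 2) F,
        ((μ (Matrix.GeneralLinearGroup.det g))⁻¹ : ℂˣ) * f.1 g
      map_add' := fun f f' => by
        simp only [Submodule.coe_add, Pi.add_apply, mul_add, Finset.sum_add_distrib]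
      map_smul' := fun c f => by
        simp only [Submodule.coe_smul, Pi.smul_apply, smul_eq_mul, mul_left_comm _ c,
          ← Finset.mul_sum, RingHom.id_apply] }
  have hdet : ℓ (detFun μ) = Nat.card (GL (Fin 2) F) := by
    simp [ℓ, detFun]
  have hcard : (Nat.card (GL (Fin 2) F) : ℂ) ≠ 0 := by simp
  have hmem : ∀ f, f ∈ steinbergSubmodule μ ↔ ℓ f = 0 := fun f => Iff.rfl
  constructor
  · rintro ⟨c, w, hw⟩ ⟨c', w', hw'⟩ h
    change c • detFun μ + w = c' • detFun μ + w' at h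
    have h1 := congrArg ℓ h
    rw [map_add, map_add, map_smul, map_smul, (hmem w).1 hw, (hmem w').1 hw', hdet, add_zero,
      add_zero, smul_eq_mul, smul_eq_mul] at h1
    obtain rfl := mul_right_cancel₀ hcard h1
    obtain rfl := add_left_cancel h
    rfl
  · intro f
    refine ⟨(ℓ f / Nat.card (GL (Fin 2) F),
      ⟨f - (ℓ f / Nat.card (GL (Fin 2) F)) • detFun μ, ?_⟩), add_sub_cancel _ _⟩
    rw [hmem, map_sub, map_smul, hdet, smul_eq_mul, div_mul_cancel₀ _ hcard, sub_self]

/-- The decomposition `V_{μ, μ} = ℂ_μ ⊕ W_μ`. -/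
theorem principalSeries_equiv_prod (μ : Fˣ →* ℂˣ) :
    Nonempty ((principalSeries μ μ).Equiv ((detRep μ).prod (steinberg μ))) := by
  let e : (ℂ × SteinbergSpace μ) →ₗ[ℂ] coindV (borel F).subtype (charRep (borelChar μ μ)) :=
    (LinearMap.toSpanSingleton ℂ _ (detFun μ)).coprod (steinbergSubmodule μ).subtype
  refine ⟨(Representation.Equiv.mk (LinearEquiv.ofBijective e (bijective_smul_detFun_add μ))
    fun g => ?_).symm⟩
  refine LinearMap.ext fun p => ?_
  change ((μ (Matrix.GeneralLinearGroup.det g) : ℂ) * p.1) • detFun μ +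
    principalSeries μ μ g (show steinbergSubmodule μ from p.2).1 =
    principalSeries μ μ g (p.1 • detFun μ + (show steinbergSubmodule μ from p.2).1)
  rw [map_add, map_smul, principalSeries_detFun, smul_smul, mul_comm]

theorem character_steinberg (μ : Fˣ →* ℂˣ) :
    (steinberg μ).character = (principalSeries μ μ).character - (detRep μ).character := by
  obtain ⟨e⟩ := principalSeries_equiv_prod μ
  rw [char_iso e, character_prod]
  simp

theorem finrank_steinbergSpace (μ : Fˣ →* ℂˣ) :
    Module.finrank ℂ (SteinbergSpace μ) = Fintype.card F := by
  obtain ⟨e⟩ := principalSeries_equiv_prod μ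
  have h := e.toLinearEquiv.finrank_eq
  rw [finrank_principalSeries, Module.finrank_prod, Module.finrank_self] at h
  omega

open Classical in
theorem charInner_steinberg_steinberg (μ μ' : Fˣ →* ℂˣ) :
    charInner (steinberg μ).character (steinberg μ').character = if μ = μ' then 1 else 0 := by
  have h1 : charInner (detRep μ).character (detRep μ').character = if μ = μ' then 1 else 0 := by
    split_ifs with h
    · rw [h]
      exact charInner_charRep_self _
    · exact charInner_eq_zero (isIrreducible_detRep μ) (isIrreducible_detRep μ')
        fun h' => h ((detRep_equiv_iff _ _).1 h').symm
  rw [character_steinberg, character_steinberg, charInner_sub_left, charInner_sub_right,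
    charInner_sub_right, h1, charInner_detRep_principalSeries,
    charInner_comm _ (detRep μ').character, charInner_detRep_principalSeries,
    charInner_principalSeries_principalSeries]
  simp only [and_self, eq_comm (a := μ') (b := μ)]
  ring

theorem isIrreducible_steinberg (μ : Fˣ →* ℂˣ) : (steinberg μ).IsIrreducible := by
  refine isIrreducible_of_charInner_eq_one _ ?_
  rw [charInner_steinberg_steinberg, if_pos rfl]

theorem steinberg_equiv_iff (μ μ' : Fˣ →* ℂˣ) :
    Nonempty ((steinberg μ).Equiv (steinberg μ')) ↔ μ = μ' := by
  rw [nonempty_equiv_iff_charInner_ne_zero (isIrreducible_steinberg μ)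
    (isIrreducible_steinberg μ'), charInner_steinberg_steinberg]
  simp

end Borelian

/-! ### The nonsplit torus -/

section Torus

variable {F E : Type*} [Field F] [Field E] [Algebra F E] (b : Module.Basis (Fin 2) F E)

theorem coe_torusEmb (z : Eˣ) :
    (torusEmb b z : Matrix (Fin 2) (Fin 2) F) = Algebra.leftMulMatrix b z := rfl

theorem torusEmb_injective : Function.Injective (torusEmb b) :=
  Units.map_injective (Algebra.leftMulMatrix_injective b)

theorem leftMulMatrix_algebraMap (a : F) :
    Algebra.leftMulMatrix b (algebraMap F E a) = Matrix.scalar (Fin 2) a := by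
  rw [AlgHom.commutes]
  rfl

/-- The inclusion `Fˣ → Eˣ`. -/
abbrev unitsIncl (F E : Type*) [Field F] [Field E] [Algebra F E] : Fˣ →* Eˣ :=
  Units.map (algebraMap F E : F →* E)

theorem unitsIncl_injective : Function.Injective (unitsIncl F E) :=
  Units.map_injective (algebraMap F E).injective

theorem torusEmb_unitsIncl (a : Fˣ) : torusEmb b (unitsIncl F E a) = upper a a 0 := by
  refine Units.ext ?_
  rw [coe_torusEmb, coe_upper]
  change Algebra.leftMulMatrix b (algebraMap F E a) = _
  rw [leftMulMatrix_algebraMap]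
  ext i j
  fin_cases i <;> fin_cases j <;> simp

theorem upper_self_zero_mul_comm (a : Fˣ) (x : GL (Fin 2) F) :
    upper a a 0 * x = x * upper a a 0 := by
  refine Units.ext ?_
  have h4 : (upper a a 0 : Matrix (Fin 2) (Fin 2) F) = Matrix.scalar (Fin 2) (a : F) := by
    ext i j
    fin_cases i <;> fin_cases j <;> simp [coe_upper]
  rw [Matrix.GeneralLinearGroup.coe_mul, Matrix.GeneralLinearGroup.coe_mul, h4]
  exact Matrix.scalar_commute _ (fun _ => Commute.all _ _) _

/-- An element of `Eˣ` whose matrix is conjugate to a triangular one lies in `Fˣ`, because it has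
an eigenvalue in `F`. -/
theorem eq_of_torusEmb_eq_conj_upper {z : Eˣ} {x : GL (Fin 2) F} {a d : Fˣ} {c : F}
    (h : torusEmb b z = x * upper a d c * x⁻¹) :
    z = unitsIncl F E a ∧ upper a d c = upper a a 0 := by
  have hz : z = unitsIncl F E a := by
    by_contra hne
    have hne' : (z : E) - algebraMap F E a ≠ 0 := by
      rw [sub_ne_zero]
      exact fun h' => hne (Units.ext h')
    have hunit : IsUnit (Algebra.leftMulMatrix b ((z : E) - algebraMap F E a)) :=
      (isUnit_iff_ne_zero.2 hne').map _
    have hconj : Algebra.leftMulMatrix b ((z : E) - algebraMap F E a) =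
        (x : Matrix (Fin 2) (Fin 2) F) * !![0, c; 0, (d : F) - a] *
          ((x⁻¹ : GL (Fin 2) F) : Matrix (Fin 2) (Fin 2) F) := by
      rw [map_sub, leftMulMatrix_algebraMap, ← coe_torusEmb, h]
      have h1 : (!![0, c; 0, (d : F) - a] : Matrix (Fin 2) (Fin 2) F) =
          upper a d c - Matrix.scalar (Fin 2) (a : F) := by
        ext i j
        fin_cases i <;> fin_cases j <;> simp [coe_upper]
      rw [h1, mul_sub, sub_mul, ← (Matrix.scalar_commute (a : F) (fun _ => Commute.all _ _)
        (x : Matrix (Fin 2) (Fin 2) F)).eq, mul_assoc (Matrix.scalar (Fin 2) (a : F)),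
        Units.mul_inv x, mul_one, Matrix.GeneralLinearGroup.coe_mul,
        Matrix.GeneralLinearGroup.coe_mul]
    rw [hconj, Matrix.isUnit_iff_isUnit_det, Matrix.det_mul, Matrix.det_mul,
      Matrix.det_fin_two_of] at hunit
    simp at hunit
  refine ⟨hz, ?_⟩
  have h2 : upper a d c = x⁻¹ * upper a a 0 * x := by
    rw [← torusEmb_unitsIncl b, ← hz, h]
    group
  rw [h2, mul_assoc]
  rw [upper_self_zero_mul_comm, inv_mul_cancel_left]

/-- Cayley–Hamilton for the multiplication by `z`. -/
theorem sq_sub_trace_mul_add_det (z : E) :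
    z ^ 2 - algebraMap F E (Algebra.leftMulMatrix b z).trace * z +
      algebraMap F E (Algebra.leftMulMatrix b z).det = 0 := by
  apply Algebra.leftMulMatrix_injective b
  rw [map_add, map_sub, map_mul, map_pow, leftMulMatrix_algebraMap, leftMulMatrix_algebraMap,
    map_zero]
  set M := Algebra.leftMulMatrix b z
  rw [Matrix.trace_fin_two, Matrix.det_fin_two]
  ext i j
  fin_cases i <;> fin_cases j <;> simp [sq, Matrix.mul_apply, Fin.sum_univ_two] <;> ring

variable [Fintype F]

include b in
theorem card_quadratic [Fintype E] : Fintype.card E = Fintype.card F ^ 2 := by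
  rw [Module.card_eq_pow_finrank (K := F), Module.finrank_eq_card_basis b, Fintype.card_fin]

include b in
theorem card_units_quadratic [Fintype E] [DecidableEq E] : (Fintype.card Eˣ : ℂ) = Fintype.card F ^ 2 - 1 := by
  rw [Fintype.card_units, Nat.cast_sub Fintype.card_pos, Nat.cast_one, card_quadratic b,
    Nat.cast_pow]

theorem pow_card_eq_self_iff (z : Eˣ) :
    z ^ Fintype.card F = z ↔ ∃ a, unitsIncl F E a = z := by
  constructor
  · intro h
    classical
    let p : Polynomial E := Polynomial.X ^ Fintype.card F - Polynomial.X
    have hp : p ≠ 0 := FiniteField.X_pow_card_sub_X_ne_zero E Fintype.one_lt_card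
    have hsub : Finset.univ.image (algebraMap F E) ⊆ p.roots.toFinset := by
      intro e he
      obtain ⟨a, -, rfl⟩ := Finset.mem_image.1 he
      rw [Multiset.mem_toFinset, Polynomial.mem_roots hp]
      simp [p, Polynomial.IsRoot, ← map_pow, FiniteField.pow_card]
    have hcard : p.roots.toFinset.card ≤ (Finset.univ.image (algebraMap F E)).card := by
      rw [Finset.card_image_of_injective _ (algebraMap F E).injective, Finset.card_univ]
      refine (Multiset.toFinset_card_le _).trans ((Polynomial.card_roots' p).trans_eq ?_)
      exact FiniteField.X_pow_card_sub_X_natDegree_eq E Fintype.one_lt_card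
    have hz : (z : E) ∈ p.roots.toFinset := by
      rw [Multiset.mem_toFinset, Polynomial.mem_roots hp]
      simp [p, Polynomial.IsRoot, ← Units.val_pow_eq_pow_val, h]
    rw [← Finset.eq_of_subset_of_card_le hsub hcard] at hz
    obtain ⟨a, -, ha⟩ := Finset.mem_image.1 hz
    have ha0 : a ≠ 0 := by
      rintro rfl
      exact z.ne_zero (by rw [← ha, map_zero])
    exact ⟨Units.mk0 a ha0, Units.ext ha⟩
  · rintro ⟨a, rfl⟩
    rw [← map_pow]
    congr 1
    ext
    simp [FiniteField.pow_card]

theorem eq_or_eq_pow_card_of_conj {w z : Eˣ} {x : GL (Fin 2) F} (hw : w ^ Fintype.card F ≠ w)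
    (h : torusEmb b z = x * torusEmb b w * x⁻¹) : z = w ∨ z = w ^ Fintype.card F := by
  have htr : (Algebra.leftMulMatrix b (z : E)).trace = (Algebra.leftMulMatrix b (w : E)).trace := by
    rw [← coe_torusEmb, ← coe_torusEmb, h]
    exact Matrix.trace_units_conj x _
  have hdet : (Algebra.leftMulMatrix b (z : E)).det = (Algebra.leftMulMatrix b (w : E)).det := by
    rw [← coe_torusEmb, ← coe_torusEmb, h]
    exact Matrix.det_units_conj x _
  have hz := sq_sub_trace_mul_add_det b (z : E)
  have hw0 := sq_sub_trace_mul_add_det b (w : E)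
  rw [htr, hdet] at hz
  -- The Frobenius conjugate of `w` is the other root of the characteristic polynomial.
  have hw1 := congrArg (FiniteField.frobeniusAlgHom F E) hw0
  rw [map_add, map_sub, map_mul, map_pow, AlgHom.commutes, AlgHom.commutes, map_zero,
    FiniteField.coe_frobeniusAlgHom] at hw1
  set t := algebraMap F E (Algebra.leftMulMatrix b (w : E)).trace
  set n := algebraMap F E (Algebra.leftMulMatrix b (w : E)).det
  have hne : (w : E) ^ Fintype.card F - w ≠ 0 := by
    rw [sub_ne_zero]
    exact fun h' => hw (Units.ext h')
  have ht : (w : E) ^ Fintype.card F + w - t = 0 := by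
    refine (mul_eq_zero.1 (?_ : ((w : E) ^ Fintype.card F - w) * _ = 0)).resolve_left hne
    linear_combination hw1 - hw0
  have hprod : ((z : E) - w) * (z - (w : E) ^ Fintype.card F) = 0 := by
    linear_combination hz - hw0 - (z - w : E) * ht
  rcases mul_eq_zero.1 hprod with h' | h'
  · exact Or.inl (Units.ext (sub_eq_zero.1 h'))
  · exact Or.inr (Units.ext (sub_eq_zero.1 h'))

omit [Fintype F] in
/-- The nonsplit torus is its own centralizer. -/
theorem mem_range_torusEmb_of_commute {w : Eˣ} (hw : ∀ a, unitsIncl F E a ≠ w)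
    {x : GL (Fin 2) F} (h : x * torusEmb b w = torusEmb b w * x) : ∃ u, torusEmb b u = x := by
  let X : E →ₗ[F] E := (LinearMap.toMatrix b b).symm (x : Matrix (Fin 2) (Fin 2) F)
  have hX : LinearMap.toMatrix b b X = x := LinearEquiv.apply_symm_apply _ _
  let A : Subalgebra F E :=
    { carrier := {y | X ∘ₗ Algebra.lmul F E y = Algebra.lmul F E y ∘ₗ X}
      mul_mem' := fun {y y'} hy hy' => by
        simp only [Set.mem_ofPred_eq] at *
        rw [map_mul, Module.End.mul_eq_comp, ← LinearMap.comp_assoc, hy, LinearMap.comp_assoc, hy',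
          LinearMap.comp_assoc]
      add_mem' := fun {y y'} hy hy' => by
        simp only [Set.mem_ofPred_eq] at *
        rw [map_add, LinearMap.comp_add, LinearMap.add_comp, hy, hy']
      algebraMap_mem' := fun a => by
        ext e
        simp }
  have hwA : (w : E) ∈ A := by
    change X ∘ₗ Algebra.lmul F E w = Algebra.lmul F E w ∘ₗ X
    apply (LinearMap.toMatrix b b).injective
    rw [LinearMap.toMatrix_comp b b b, LinearMap.toMatrix_comp b b b, hX,
      ← Algebra.leftMulMatrix_apply]
    exact congrArg Units.val h
  have hfin : Module.finrank F E = 2 := by simp [Module.finrank_eq_card_basis b]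
  have hsimple := Subalgebra.isSimpleOrder_of_finrank_prime F E (by rw [hfin]; exact Nat.prime_two)
  have htop : A = ⊤ := by
    refine (hsimple.eq_bot_or_eq_top A).resolve_left fun hbot => ?_
    rw [hbot] at hwA
    obtain ⟨a, ha⟩ := Algebra.mem_bot.1 hwA
    have ha0 : a ≠ 0 := by
      rintro rfl
      exact w.ne_zero (by rw [← ha, map_zero])
    exact hw (Units.mk0 a ha0) (Units.ext ha)
  have hlin : ∀ e, X e = X 1 * e := fun e => by
    have he : e ∈ A := htop ▸ Algebra.mem_top
    have := LinearMap.congr_fun (show X ∘ₗ Algebra.lmul F E e = Algebra.lmul F E e ∘ₗ X from he) 1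
    simpa [mul_comm] using this
  have hmul : Algebra.leftMulMatrix b (X 1) = x := by
    rw [← hX, Algebra.leftMulMatrix_apply]
    congr 1
    ext e
    exact (hlin e).symm
  have h1 : X 1 ≠ 0 := fun h0 => by
    rw [h0, map_zero] at hmul
    exact x.ne_zero hmul.symm
  exact ⟨Units.mk0 (X 1) h1, Units.ext hmul⟩

/-- Frobenius, as an `F`-linear automorphism of `E`, conjugates the torus into itself. -/
theorem exists_conj_torusEmb_pow_card :
    ∃ y : GL (Fin 2) F, ∀ w, y * torusEmb b w = torusEmb b (w ^ Fintype.card F) * y := by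
  let φ := FiniteField.frobeniusAlgHom F E
  have hφ : Function.Injective φ.toLinearMap := φ.toRingHom.injective
  have : Module.Finite F E := .of_basis b
  have hunit : IsUnit (LinearMap.toMatrix b b φ.toLinearMap) := by
    rw [LinearMap.isUnit_toMatrix_iff]
    exact (Module.End.isUnit_iff _).2 ⟨hφ, LinearMap.injective_iff_surjective.1 hφ⟩
  obtain ⟨y, hy⟩ := hunit
  refine ⟨y, fun w => Units.ext ?_⟩
  rw [Matrix.GeneralLinearGroup.coe_mul, Matrix.GeneralLinearGroup.coe_mul, hy, coe_torusEmb,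
    coe_torusEmb, Algebra.leftMulMatrix_apply, Algebra.leftMulMatrix_apply,
    ← LinearMap.toMatrix_comp b b b, ← LinearMap.toMatrix_comp b b b]
  congr 1
  ext e
  simp [φ, mul_pow]

end Torus

/-! ### The complementary series -/

section ComplementarySeries

variable {F E : Type*} [Field F] [Field E] [Algebra F E] (b : Module.Basis (Fin 2) F E)
  [Fintype F] [DecidableEq F] [Fintype E] [DecidableEq E]

theorem eq_conj_iff_mul_eq_mul {G : Type*} [Group G] (u v x : G) :
    u = x * v * x⁻¹ ↔ u * x = x * v := by
  rw [eq_mul_inv_iff_mul_eq]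

include b in
theorem card_GL_two_complex : (Nat.card (GL (Fin 2) F) : ℂ) =
    Fintype.card Eˣ * (Fintype.card F * (Fintype.card F - 1)) := by
  rw [card_GL_two, Nat.cast_mul, card_borel_complex, card_units_quadratic b]
  push_cast
  ring

theorem character_torusInd_upper (ν : Eˣ →* ℂˣ) (a d : Fˣ) (c : F) :
    (torusInd b ν).character (upper a d c) =
      if a = d ∧ c = 0 then Fintype.card F * (Fintype.card F - 1 : ℂ) * resChar ν a else 0 := by
  have hK : (Fintype.card Eˣ : ℂ) ≠ 0 := by simp
  rw [character_coind]
  split_ifs with h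
  · obtain ⟨rfl, rfl⟩ := h
    have hx : ∀ x : GL (Fin 2) F, ∑ z : Eˣ, (if torusEmb b z = x * upper a a 0 * x⁻¹ then
        (ν z : ℂ) else 0) = resChar ν a := by
      intro x
      have hz : ∀ z, torusEmb b z = x * upper a a 0 * x⁻¹ ↔ z = unitsIncl F E a := by
        intro z
        refine ⟨fun h => (eq_of_torusEmb_eq_conj_upper b h).1, ?_⟩
        rintro rfl
        rw [torusEmb_unitsIncl, eq_conj_iff_mul_eq_mul, upper_self_zero_mul_comm]
      simp [hz]
    rw [Finset.sum_congr rfl fun x _ => hx x, Finset.sum_const, Finset.card_univ,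
      ← Nat.card_eq_fintype_card, nsmul_eq_mul, card_GL_two_complex b, Nat.card_eq_fintype_card]
    field_simp
  · rw [Finset.sum_eq_zero, mul_zero]
    intro x _
    refine Finset.sum_eq_zero fun z _ => if_neg fun hz => h ?_
    have h1 := (eq_of_torusEmb_eq_conj_upper b hz).2
    have h2 := congrArg (fun g : GL (Fin 2) F => g 0 1) h1
    have h3 := congrArg (fun g : GL (Fin 2) F => g 1 1) h1
    simp only [coe_upper] at h2 h3
    exact ⟨Units.ext (by simpa using h3.symm), by simpa using h2⟩

theorem character_torusInd_torusEmb (ν : Eˣ →* ℂˣ) {w : Eˣ} (hw : w ^ Fintype.card F ≠ w) :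
    (torusInd b ν).character (torusEmb b w) = ν w + ν (w ^ Fintype.card F) := by
  have hK : (Fintype.card Eˣ : ℂ) ≠ 0 := by simp
  have hw' : ∀ a, unitsIncl F E a ≠ w := fun a ha => hw ((pow_card_eq_self_iff w).2 ⟨a, ha⟩)
  have hcount : ∑ x : GL (Fin 2) F, (if torusEmb b w = x * torusEmb b w * x⁻¹ then (1 : ℂ) else 0) =
      Fintype.card Eˣ := by
    have : Finset.univ.filter (fun x : GL (Fin 2) F =>
        torusEmb b w = x * torusEmb b w * x⁻¹) = Finset.univ.image (torusEmb b) := by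
      ext x
      simp only [Finset.mem_filter, Finset.mem_univ, true_and, Finset.mem_image,
        eq_conj_iff_mul_eq_mul]
      constructor
      · intro h
        exact mem_range_torusEmb_of_commute b hw' h.symm
      · rintro ⟨u, rfl⟩
        rw [← map_mul, ← map_mul, mul_comm]
    rw [← Finset.sum_filter, this, Finset.sum_const,
      Finset.card_image_of_injective _ (torusEmb_injective b)]
    simp
  have hcount' : ∑ x : GL (Fin 2) F, (if torusEmb b (w ^ Fintype.card F) =
      x * torusEmb b w * x⁻¹ then (1 : ℂ) else 0) = Fintype.card Eˣ := by
    obtain ⟨y, hy⟩ := exists_conj_torusEmb_pow_card b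
    rw [← hcount, ← Equiv.sum_comp (Equiv.mulLeft y)]
    refine Finset.sum_congr rfl fun x _ => ?_
    simp only [Equiv.coe_mulLeft, eq_conj_iff_mul_eq_mul]
    refine if_congr ?_ rfl rfl
    rw [← mul_assoc, ← hy, mul_assoc, mul_assoc, mul_right_inj]
  have hsum : ∀ x : GL (Fin 2) F, ∑ z : Eˣ, (if torusEmb b z = x * torusEmb b w * x⁻¹ then
      (ν z : ℂ) else 0) =
      (if torusEmb b w = x * torusEmb b w * x⁻¹ then 1 else 0) * ν w +
      (if torusEmb b (w ^ Fintype.card F) = x * torusEmb b w * x⁻¹ then 1 else 0) *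
        ν (w ^ Fintype.card F) := by
    intro x
    rw [← Finset.sum_subset (Finset.subset_univ {w, w ^ Fintype.card F}),
      Finset.sum_pair hw.symm, ite_mul, ite_mul, one_mul, one_mul, zero_mul]
    · rw [zero_mul]
    · intro z _ hz
      refine if_neg fun h => hz ?_
      simpa using eq_or_eq_pow_card_of_conj b hw h
  rw [character_coind, Finset.sum_congr rfl fun x _ => hsum x, Finset.sum_add_distrib,
    ← Finset.sum_mul, ← Finset.sum_mul, hcount, hcount', Nat.card_eq_fintype_card]
  field_simp

omit [Fintype E] [DecidableEq E] in
theorem character_principalSeries_torusEmb (l₁ l₂ : Fˣ →* ℂˣ) {w : Eˣ}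
    (hw : w ^ Fintype.card F ≠ w) :
    (principalSeries l₁ l₂).character (torusEmb b w) = 0 := by
  rw [character_coind, Finset.sum_eq_zero, mul_zero]
  intro x _
  refine Finset.sum_eq_zero fun h _ => if_neg fun hh => hw ?_
  obtain ⟨⟨a, d, c⟩, rfl⟩ := borelEquiv.surjective h
  rw [pow_card_eq_self_iff]
  refine ⟨a, (eq_of_torusEmb_eq_conj_upper b (x := x⁻¹) (d := d) (c := c) ?_).1.symm⟩
  change upper a d c = _ at hh
  rw [hh]
  group

/-- The number of fixed points on the projective line minus two; the factor by which
`W_1 ⊗ V - V` differs from `V` on the level of characters. -/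
def fixedSubTwo (g : GL (Fin 2) F) : ℂ :=
  (principalSeries (1 : Fˣ →* ℂˣ) 1).character g - 2

omit [Fintype E] [DecidableEq E] in
theorem complementaryChar_eq (ν : Eˣ →* ℂˣ) (g : GL (Fin 2) F) :
    complementaryChar b ν g =
      fixedSubTwo g * (principalSeries (resChar ν) 1).character g - (torusInd b ν).character g := by
  rw [complementaryChar, char_tensor, character_steinberg, fixedSubTwo]
  simp only [Pi.mul_apply, Pi.sub_apply, character_charRep]
  simp
  ring

/-- On `B` the virtual character is supported on the matrices with equal diagonal entries. -/
theorem complementaryChar_upper (ν : Eˣ →* ℂˣ) (a d : Fˣ) (c : F) :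
    complementaryChar b ν (upper a d c) =
      if a = d then resChar ν a * (if c = 0 then (Fintype.card F : ℂ) - 1 else -1) else 0 := by
  rw [complementaryChar_eq, fixedSubTwo, character_principalSeries, character_principalSeries,
    character_torusInd_upper]
  by_cases had : a = d
  · subst had
    by_cases hc : c = 0 <;> simp [hc] <;> ring
  · have hsub : (a : F) - d ≠ 0 := by
      rw [sub_ne_zero]
      exact fun h => had (Units.ext h)
    have ht : ∀ t : F, c = t * (a - d) ↔ t = c / (a - d) := fun t => by
      rw [eq_div_iff hsub, eq_comm]
    simp only [had, ht, false_and, if_false, sub_zero, Finset.sum_ite_eq', Finset.mem_univ,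
      if_true, MonoidHom.one_apply, Units.val_one]
    ring

/-- On the torus the virtual character is `-(ν + ν ^ q)`, with a correction on `Fˣ`, where `ν` and
`ν ^ q` agree; the correction is written as a sum over `Fˣ` with at most one nonzero term. -/
theorem complementaryChar_torusEmb (ν : Eˣ →* ℂˣ) (z : Eˣ) :
    complementaryChar b ν (torusEmb b z) =
      -(ν z + (ν ^ Fintype.card F) z) +
        ∑ a : Fˣ, if unitsIncl F E a = z then (Fintype.card F + 1 : ℂ) * ν z else 0 := by
  by_cases hz : z ^ Fintype.card F = z
  · obtain ⟨a, rfl⟩ := (pow_card_eq_self_iff z).1 hz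
    have h1 : (ν ^ Fintype.card F) (unitsIncl F E a) = ν (unitsIncl F E a) := by
      rw [MonoidHom.pow_apply, ← map_pow, hz]
    rw [torusEmb_unitsIncl, complementaryChar_upper, h1]
    simp only [(unitsIncl_injective (F := F) (E := E)).eq_iff]
    simp
    ring
  · have h1 : ∀ a, unitsIncl F E a ≠ z := fun a ha => hz ((pow_card_eq_self_iff z).2 ⟨a, ha⟩)
    rw [complementaryChar_eq, character_principalSeries_torusEmb b _ _ hz,
      character_torusInd_torusEmb b ν hz]
    simp [h1]

omit [Fintype E] [DecidableEq E] in
theorem complementaryChar_conj (ν : Eˣ →* ℂˣ) (x g : GL (Fin 2) F) :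
    complementaryChar b ν (x * g * x⁻¹) = complementaryChar b ν g := by
  simp only [complementaryChar_eq, fixedSubTwo, char_conj]

open Classical in
theorem charInner_complementaryChar_torusInd (ν ν' : Eˣ →* ℂˣ) :
    charInner (complementaryChar b ν) (torusInd b ν').character =
      (if resChar (F := F) ν = resChar ν' then 1 else 0) - (if ν = ν' then 1 else 0) -
        (if ν ^ Fintype.card F = ν' then 1 else 0) := by
  have hK : (Fintype.card Eˣ : ℂ) ≠ 0 := by simp
  have hq1 := card_units_complex (F := F)
  have hE := card_units_quadratic b
  rw [charInner_coind _ _ _ (complementaryChar_conj b ν)]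
  have h : ∀ z, complementaryChar b ν (torusEmb b z) * (ν' z⁻¹ : ℂ) =
      -((ν z : ℂ) * (ν' z : ℂ)⁻¹) - (((ν ^ Fintype.card F) z : ℂˣ) : ℂ) * (ν' z : ℂ)⁻¹ +
        (Fintype.card F + 1 : ℂ) *
          ∑ a : Fˣ, if unitsIncl F E a = z then (ν z : ℂ) * (ν' z : ℂ)⁻¹ else 0 := fun z => by
    rw [complementaryChar_torusEmb, add_mul, Finset.sum_mul, Finset.mul_sum, map_inv,
      Units.val_inv_eq_inv_val]
    congr 1
    · ring
    · refine Finset.sum_congr rfl fun a _ => ?_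
      split_ifs <;> ring
  have h2 : ∑ z : Eˣ, ∑ a : Fˣ, (if unitsIncl F E a = z then (ν z : ℂ) * (ν' z : ℂ)⁻¹ else 0) =
      if resChar (F := F) ν = resChar ν' then (Fintype.card Fˣ : ℂ) else 0 := by
    rw [Finset.sum_comm, ← sum_mul_inv_monoidHom]
    simp
  simp only [h, Finset.sum_add_distrib, Finset.sum_sub_distrib, Finset.sum_neg_distrib,
    ← Finset.mul_sum, h2, sum_mul_inv_monoidHom, Nat.card_eq_fintype_card]
  have h3 : (Fintype.card F + 1 : ℂ) * Fintype.card Fˣ = Fintype.card Eˣ := by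
    rw [hq1, hE]
    ring
  simp only [mul_ite, mul_zero, h3]
  split_ifs <;> (field_simp; ring)

open Classical in
/-- The contribution of `(n - 2) V_{α', 1}` to `⟨θ_ν, θ_ν'⟩`: the factor `n - 2`, taken at `g⁻¹`, is
moved to the other argument of the pairing, so that Frobenius reciprocity applies. -/
theorem charInner_complementaryChar_mul_principalSeries (ν ν' : Eˣ →* ℂˣ) :
    charInner (fun g => complementaryChar b ν g * fixedSubTwo g⁻¹)
        (principalSeries (resChar ν') 1).character =
      if resChar (F := F) ν = resChar ν' then 1 else 0 := by
  have hq : (Fintype.card F : ℂ) ≠ 0 := by simp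
  have hq1 := card_sub_one_ne_zero (F := F)
  rw [charInner_principalSeries]
  · have hinv : ∀ (a : Fˣ) (c : F), fixedSubTwo (upper a a c)⁻¹ =
        if c = 0 then (Fintype.card F : ℂ) - 1 else -1 := fun a c => by
      rw [upper_inv, fixedSubTwo, character_principalSeries]
      by_cases hc : c = 0 <;> simp [hc] <;> ring
    have h1 : ∀ a d : Fˣ, (∑ c : F, complementaryChar b ν (upper a d c) *
        fixedSubTwo (upper a d c)⁻¹) =
        if a = d then (Fintype.card F * (Fintype.card F - 1) : ℂ) * resChar ν a else 0 := by
      intro a d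
      split_ifs with had
      · subst had
        have h2 : ∀ c : F, complementaryChar b ν (upper a a c) * fixedSubTwo (upper a a c)⁻¹ =
            resChar ν a + if c = 0 then
              (resChar ν a : ℂ) * ((Fintype.card F - 1 : ℂ) ^ 2 - 1) else 0 := fun c => by
          rw [complementaryChar_upper, hinv]
          by_cases hc : c = 0
          · simp only [hc, if_true]
            ring
          · simp [hc]
        simp only [h2, Finset.sum_add_distrib, Finset.sum_ite_eq', Finset.mem_univ, if_true,
          Finset.sum_const, Finset.card_univ, nsmul_eq_mul]
        ring
      · refine Finset.sum_eq_zero fun c _ => ?_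
        rw [complementaryChar_upper, if_neg had, zero_mul]
    simp only [h1, ite_mul, zero_mul, Finset.sum_ite_eq, Finset.mem_univ, if_true,
      MonoidHom.one_apply, Units.val_one, inv_one, mul_one, mul_assoc, ← Finset.mul_sum,
      sum_mul_inv_monoidHom]
    rw [card_borel_complex, card_units_complex]
    split_ifs
    · field_simp
    · simp
  · intro x g
    simp only [complementaryChar_conj, fixedSubTwo, mul_inv_rev, inv_inv]
    rw [← mul_assoc, char_conj]

open Classical in
theorem charInner_complementaryChar (ν ν' : Eˣ →* ℂˣ) :
    charInner (complementaryChar b ν) (complementaryChar b ν') =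
      (if ν = ν' then 1 else 0) + (if ν ^ Fintype.card F = ν' then 1 else 0) := by
  have h : charInner (complementaryChar b ν) (complementaryChar b ν') =
      charInner (fun g => complementaryChar b ν g * fixedSubTwo g⁻¹)
        (principalSeries (resChar ν') 1).character -
      charInner (complementaryChar b ν) (torusInd b ν').character := by
    rw [charInner, charInner, charInner, ← mul_sub, ← Finset.sum_sub_distrib]
    congr 1
    refine Finset.sum_congr rfl fun g _ => ?_
    rw [complementaryChar_eq b ν' g⁻¹]
    ring
  rw [h, charInner_complementaryChar_mul_principalSeries, charInner_complementaryChar_torusInd]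
  ring

/-- The virtual character is `χ_A - χ_B` for `A = W_1 ⊗ V_{α, 1}` and `B = V_{α, 1} ⊕ Ind ν`; it
has norm one and degree `q - 1`. -/
theorem exists_complementarySeries (ν : Eˣ →* ℂˣ) (hν : ν ^ Fintype.card F ≠ ν) :
    ∃ ρ : Representation ℂ (GL (Fin 2) F) (Fin (Fintype.card F - 1) → ℂ),
      ρ.IsIrreducible ∧ ρ.character = complementaryChar b ν := by
  let A := (steinberg (1 : Fˣ →* ℂˣ)).tprod (principalSeries (resChar ν) 1)
  let B := (principalSeries (resChar ν) (1 : Fˣ →* ℂˣ)).prod (torusInd b ν)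
  have hAB : A.character - B.character = complementaryChar b ν := by
    ext g
    simp only [A, B, character_prod, complementaryChar, Pi.sub_apply, Pi.add_apply]
    ring
  rw [← hAB]
  refine exists_isIrreducible_of_charInner_sub_eq_one (isCharacter_character A)
    (isCharacter_character B) ?_ ?_
  · rw [hAB, charInner_complementaryChar, if_pos rfl, if_neg hν, add_zero]
  · have h1 : (1 : GL (Fin 2) F) = upper 1 1 0 := by
      ext i j
      fin_cases i <;> fin_cases j <;> simp [coe_upper]
    rw [hAB, h1, complementaryChar_upper, Nat.cast_sub Fintype.card_pos]
    simp

open Classical in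
/-- The representation `Y_ν` for `ν ^ q ≠ ν`, with the trivial action of `G` as a default value
for other `ν`. -/
def complementarySeries (ν : Eˣ →* ℂˣ) :
    Representation ℂ (GL (Fin 2) F) (Fin (Fintype.card F - 1) → ℂ) :=
  if h : ν ^ Fintype.card F ≠ ν then (exists_complementarySeries b ν h).choose else 1

variable {b} {ν ν' : Eˣ →* ℂˣ}

theorem isIrreducible_complementarySeries (hν : ν ^ Fintype.card F ≠ ν) :
    (complementarySeries b ν).IsIrreducible := by
  rw [complementarySeries, dif_pos hν]
  exact (exists_complementarySeries b ν hν).choose_spec.1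

theorem character_complementarySeries (hν : ν ^ Fintype.card F ≠ ν) :
    (complementarySeries b ν).character = complementaryChar b ν := by
  rw [complementarySeries, dif_pos hν]
  exact (exists_complementarySeries b ν hν).choose_spec.2

theorem complementarySeries_equiv_iff (hν : ν ^ Fintype.card F ≠ ν)
    (hν' : ν' ^ Fintype.card F ≠ ν') :
    Nonempty ((complementarySeries b ν).Equiv (complementarySeries b ν')) ↔
      ν' = ν ∨ ν' = ν ^ Fintype.card F := by
  rw [nonempty_equiv_iff_charInner_ne_zero (isIrreducible_complementarySeries hν)
    (isIrreducible_complementarySeries hν'), character_complementarySeries hν,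
    character_complementarySeries hν', charInner_complementaryChar, eq_comm (a := ν'),
    eq_comm (a := ν')]
  by_cases h1 : ν = ν'
  · subst h1
    simp [hν]
  · by_cases h2 : ν ^ Fintype.card F = ν' <;> simp [h1, h2]

end ComplementarySeries

/-! ### Counting isomorphism classes -/

section Counting

variable {F : Type*} [Field F] [Fintype F] [DecidableEq F]

instance finiteMonoidHomUnits (A : Type*) [CommGroup A] [Finite A] : Finite (A →* ℂˣ) :=
  .of_equiv A (CommGroup.monoidHom_mulEquiv_of_hasEnoughRootsOfUnity A ℂ).some.symm.toEquiv

theorem card_monoidHom_units : Nat.card (Fˣ →* ℂˣ) = Fintype.card F - 1 := by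
  rw [CommGroup.card_monoidHom_of_hasEnoughRootsOfUnity Fˣ ℂ, Nat.card_eq_fintype_card,
    Fintype.card_units]

variable (F) in
/-- The isomorphism classes of the one-dimensional representations `ℂ_ξ`. -/
def detClasses : Set (Quotient (finRepSetoid (G := GL (Fin 2) F))) :=
  (fun ξ : Fˣ →* ℂˣ => isoClass (detRep ξ)) '' Set.univ

variable (F) in
/-- The isomorphism classes of the `V_{l₁, l₂}` with `l₁ ≠ l₂`. -/
def principalClasses : Set (Quotient (finRepSetoid (G := GL (Fin 2) F))) :=
  (fun p : (Fˣ →* ℂˣ) × (Fˣ →* ℂˣ) => isoClass (principalSeries p.1 p.2)) '' {p | p.1 ≠ p.2}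

variable (F) in
/-- The isomorphism classes of the representations `W_μ`. -/
def steinbergClasses : Set (Quotient (finRepSetoid (G := GL (Fin 2) F))) :=
  (fun μ : Fˣ →* ℂˣ => isoClass (steinberg μ)) '' Set.univ

theorem ncard_detClasses : (detClasses F).ncard = Fintype.card F - 1 := by
  rw [detClasses, Set.ncard_image_of_injective, Set.ncard_univ, card_monoidHom_units]
  exact fun ξ ξ' h => (detRep_equiv_iff ξ ξ').1 ((isoClass_eq_iff _ _).1 h)

theorem ncard_steinbergClasses : (steinbergClasses F).ncard = Fintype.card F - 1 := by
  rw [steinbergClasses, Set.ncard_image_of_injective, Set.ncard_univ, card_monoidHom_units]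
  exact fun μ μ' h => (steinberg_equiv_iff μ μ').1 ((isoClass_eq_iff _ _).1 h)

theorem two_mul_ncard_principalClasses :
    2 * (principalClasses F).ncard = (Fintype.card F - 1) * (Fintype.card F - 2) := by
  classical
  have := Fintype.ofFinite (Fˣ →* ℂˣ)
  have hset : {p : (Fˣ →* ℂˣ) × (Fˣ →* ℂˣ) | p.1 ≠ p.2} =
      ((Finset.univ : Finset (Fˣ →* ℂˣ)).offDiag : Set _) := by
    ext p
    simp
  rw [principalClasses, hset, two_mul_ncard_image _ _ Prod.swap, Finset.offDiag_card,
    Finset.card_univ, ← Nat.card_eq_fintype_card, card_monoidHom_units, ← Nat.mul_sub_one,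
    Nat.sub_sub]
  · simp [eq_comm]
  · rintro ⟨l₁, l₂⟩ h
    simpa [eq_comm] using h
  · rintro ⟨l₁, l₂⟩ h ⟨l₁', l₂'⟩ h'
    simp only [Finset.mem_offDiag, Finset.mem_univ, true_and] at h h'
    rw [isoClass_eq_iff, principalSeries_equiv_iff h h']
    simp only [Prod.mk.injEq, Prod.swap_prod_mk, eq_comm (a := l₁), eq_comm (a := l₂)]
    tauto

theorem isoClass_mem_isoClasses {G V : Type*} [Group G] [Finite G] [AddCommGroup V] [Module ℂ V]
    [FiniteDimensional ℂ V] {ρ : Representation ℂ G V} (h : ρ.IsIrreducible) :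
    isoClass ρ ∈ isoClasses fun ρ : FinRep G => ρ.2.IsIrreducible := by
  have := Fintype.ofFinite G
  obtain ⟨e⟩ := (exists_equiv_pi ρ rfl).choose_spec
  exact ⟨_, (isIrreducible_congr e).1 h, rfl⟩

variable {E : Type*} [Field E] [Algebra F E] (b : Module.Basis (Fin 2) F E)
  [Fintype E] [DecidableEq E]

/-- The isomorphism classes of the representations `Y_ν`. -/
def complementaryClasses : Set (Quotient (finRepSetoid (G := GL (Fin 2) F))) :=
  (fun ν : Eˣ →* ℂˣ => isoClass (complementarySeries b ν)) '' {ν | ν ^ Fintype.card F ≠ ν}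

include b in
/-- The character group of `Eˣ` is isomorphic to `Eˣ`, where the solutions of `z ^ q = z` are the
elements of `Fˣ`. -/
theorem card_pow_ne_self :
    Nat.card {ν : Eˣ →* ℂˣ // ν ^ Fintype.card F ≠ ν} =
      Fintype.card F * (Fintype.card F - 1) := by
  classical
  have := Fintype.ofFinite (Eˣ →* ℂˣ)
  have e : (Eˣ →* ℂˣ) ≃* Eˣ := (CommGroup.monoidHom_mulEquiv_of_hasEnoughRootsOfUnity Eˣ ℂ).some
  have h1 : Nat.card {ν : Eˣ →* ℂˣ // ν ^ Fintype.card F = ν} = Fintype.card F - 1 := by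
    rw [← Fintype.card_units, ← Nat.card_eq_fintype_card (α := Fˣ)]
    refine Nat.card_congr ((e.toEquiv.subtypeEquiv (q := fun z => ∃ a, unitsIncl F E a = z)
      fun ν => ?_).trans (Equiv.ofInjective (unitsIncl F E) unitsIncl_injective).symm)
    have hpow : e (ν ^ Fintype.card F) = e ν ^ Fintype.card F := map_pow e ν _
    rw [← pow_card_eq_self_iff, ← e.injective.eq_iff, hpow]
    rfl
  have h2 : Fintype.card (Eˣ →* ℂˣ) = Fintype.card F ^ 2 - 1 := by
    rw [Fintype.card_congr e.toEquiv, Fintype.card_units, card_quadratic b]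
  rw [Nat.card_eq_fintype_card] at h1 ⊢
  rw [Fintype.card_subtype_compl, h1, h2]
  obtain ⟨k, hk⟩ := Nat.exists_eq_add_of_le' (Fintype.card_pos (α := F))
  rw [hk, Nat.add_sub_cancel, Nat.sub_sub, Nat.sub_eq_iff_eq_add (by nlinarith)]
  ring

theorem two_mul_ncard_complementaryClasses :
    2 * (complementaryClasses b).ncard = Fintype.card F * (Fintype.card F - 1) := by
  classical
  have := Fintype.ofFinite (Eˣ →* ℂˣ)
  have hset : {ν : Eˣ →* ℂˣ | ν ^ Fintype.card F ≠ ν} =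
      ((Finset.univ.filter fun ν : Eˣ →* ℂˣ => ν ^ Fintype.card F ≠ ν : Finset _) : Set _) := by
    ext ν
    simp
  have hinv : ∀ ν : Eˣ →* ℂˣ, (ν ^ Fintype.card F) ^ Fintype.card F = ν := fun ν => by
    ext z
    rw [MonoidHom.pow_apply, MonoidHom.pow_apply, ← pow_mul, ← sq, ← card_quadratic b, ← map_pow]
    congr 2
    ext
    simp [FiniteField.pow_card]
  rw [complementaryClasses, hset, two_mul_ncard_image _ _ (fun ν => ν ^ Fintype.card F),
    ← card_pow_ne_self b, Nat.card_eq_fintype_card, Fintype.card_subtype]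
  · intro ν hν
    simp only [Finset.mem_filter, Finset.mem_univ, true_and, hinv] at hν ⊢
    exact hν.symm
  · intro ν hν
    simpa using hν
  · intro ν hν ν' hν'
    simp only [Finset.mem_filter, Finset.mem_univ, true_and] at hν hν'
    rw [isoClass_eq_iff, complementarySeries_equiv_iff hν hν']

/-! ### Completeness of the list -/

omit [Fintype F] [DecidableEq F] in
theorem classDim_of_mem_detClasses {c} (hc : c ∈ detClasses F) : classDim c = 1 := by
  obtain ⟨ξ, -, rfl⟩ := hc
  simp [classDim_isoClass]

theorem classDim_of_mem_principalClasses {c} (hc : c ∈ principalClasses F) :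
    classDim c = Fintype.card F + 1 := by
  obtain ⟨p, -, rfl⟩ := hc
  exact finrank_principalSeries p.1 p.2

theorem classDim_of_mem_steinbergClasses {c} (hc : c ∈ steinbergClasses F) :
    classDim c = Fintype.card F := by
  obtain ⟨μ, -, rfl⟩ := hc
  exact finrank_steinbergSpace μ

theorem classDim_of_mem_complementaryClasses {c} (hc : c ∈ complementaryClasses b) :
    classDim c = Fintype.card F - 1 := by
  obtain ⟨ν, -, rfl⟩ := hc
  simp [classDim_isoClass]

omit [DecidableEq F] in
theorem three_le_card (hF : ringChar F ≠ 2) : 3 ≤ Fintype.card F := by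
  have h1 := FiniteField.odd_card_of_char_ne_two hF
  have h2 := Fintype.one_lt_card (α := F)
  omega

/-- The list of irreducible representations is complete: its four families are disjoint, since
they have different dimensions, and the sum of the squares of the dimensions is
`(q - 1) + (q - 1) * (q - 2) / 2 * (q + 1) ^ 2 + (q - 1) * q ^ 2 + q * (q - 1) / 2 * (q - 1) ^ 2`,
which is the order `q * (q - 1) ^ 2 * (q + 1)` of the group. -/
theorem isoClasses_isIrreducible_eq (hF : ringChar F ≠ 2) :
    (isoClasses fun ρ : FinRep (GL (Fin 2) F) => ρ.2.IsIrreducible) =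
      detClasses F ∪ (principalClasses F ∪ (steinbergClasses F ∪ complementaryClasses b)) ∧
    (isoClasses fun ρ : FinRep (GL (Fin 2) F) => ρ.2.IsIrreducible).ncard =
      Fintype.card F ^ 2 - 1 := by
  classical
  have hq := three_le_card hF
  have f1 : (detClasses F).Finite := (Set.toFinite _).image _
  have f2 : (principalClasses F).Finite := (Set.toFinite _).image _
  have f3 : (steinbergClasses F).Finite := (Set.toFinite _).image _
  have f4 : (complementaryClasses b).Finite := (Set.toFinite _).image _
  have d34 : Disjoint (steinbergClasses F) (complementaryClasses b) :=
    Set.disjoint_left.2 fun c h3 h4 => by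
      have := classDim_of_mem_steinbergClasses h3
      have := classDim_of_mem_complementaryClasses b h4
      omega
  have d2 : Disjoint (principalClasses F) (steinbergClasses F ∪ complementaryClasses b) :=
    Set.disjoint_left.2 fun c h2 h34 => by
      have := classDim_of_mem_principalClasses h2
      rcases h34 with h | h
      · have := classDim_of_mem_steinbergClasses h
        omega
      · have := classDim_of_mem_complementaryClasses b h
        omega
  have d1 : Disjoint (detClasses F)
      (principalClasses F ∪ (steinbergClasses F ∪ complementaryClasses b)) :=
    Set.disjoint_left.2 fun c h1 h234 => by
      have := classDim_of_mem_detClasses h1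
      rcases h234 with h | h | h
      · have := classDim_of_mem_principalClasses h
        omega
      · have := classDim_of_mem_steinbergClasses h
        omega
      · have := classDim_of_mem_complementaryClasses b h
        omega
  have n1 := ncard_detClasses (F := F)
  have n2 := two_mul_ncard_principalClasses (F := F)
  have n3 := ncard_steinbergClasses (F := F)
  have n4 := two_mul_ncard_complementaryClasses b
  obtain ⟨k, hk⟩ := Nat.exists_eq_add_of_le' hq
  have hirr : ∀ c ∈ detClasses F ∪ (principalClasses F ∪
      (steinbergClasses F ∪ complementaryClasses b)),
      c ∈ isoClasses fun ρ : FinRep (GL (Fin 2) F) => ρ.2.IsIrreducible := by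
    rintro c (⟨ξ, -, rfl⟩ | ⟨p, hp, rfl⟩ | ⟨μ, -, rfl⟩ | ⟨ν, hν, rfl⟩)
    · exact isoClass_mem_isoClasses (isIrreducible_detRep ξ)
    · exact isoClass_mem_isoClasses (isIrreducible_principalSeries hp)
    · exact isoClass_mem_isoClasses (isIrreducible_steinberg μ)
    · exact isoClass_mem_isoClasses (isIrreducible_complementarySeries hν)
  have hsum : ∀ {S : Set (Quotient (finRepSetoid (G := GL (Fin 2) F)))} (hS : S.Finite) {n : ℕ},
      (∀ c ∈ S, classDim c = n) → ∑ c ∈ hS.toFinset, classDim c ^ 2 = S.ncard * n ^ 2 := by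
    intro S hS n hn
    rw [Set.ncard_eq_toFinset_card S hS, ← smul_eq_mul, ← Finset.sum_const]
    exact Finset.sum_congr rfl fun c hc => by rw [hn c (hS.mem_toFinset.1 hc)]
  have hcard : ∑ c ∈ (f1.union (f2.union (f3.union f4))).toFinset, classDim c ^ 2 =
      Nat.card (GL (Fin 2) F) := by
    rw [Set.Finite.toFinset_union f1 (f2.union (f3.union f4)),
      Finset.sum_union (Set.Finite.disjoint_toFinset.2 d1),
      Set.Finite.toFinset_union f2 (f3.union f4),
      Finset.sum_union (Set.Finite.disjoint_toFinset.2 d2),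
      Set.Finite.toFinset_union f3 f4,
      Finset.sum_union (Set.Finite.disjoint_toFinset.2 d34),
      hsum f1 fun c => classDim_of_mem_detClasses,
      hsum f2 fun c => classDim_of_mem_principalClasses,
      hsum f3 fun c => classDim_of_mem_steinbergClasses,
      hsum f4 fun c => classDim_of_mem_complementaryClasses b, n1, n3, card_GL_two, card_borel]
    rw [hk] at n2 n4 ⊢
    simp only [show k + 3 - 1 = k + 2 by omega,
      show k + 3 - 2 = k + 1 by omega] at n2 n4 ⊢
    refine Nat.eq_of_mul_eq_mul_left two_pos ?_
    linear_combination (k + 4) ^ 2 * n2 + (k + 2) ^ 2 * n4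
  have heq : (isoClasses fun ρ : FinRep (GL (Fin 2) F) => ρ.2.IsIrreducible) =
      detClasses F ∪ (principalClasses F ∪ (steinbergClasses F ∪ complementaryClasses b)) := by
    refine Set.Subset.antisymm ?_ hirr
    rintro c ⟨ρ, hρ, rfl⟩
    have h := mem_of_sum_classDim_sq_eq_card _
      (fun c hc => hirr c ((Set.Finite.mem_toFinset _).1 hc)) hcard ρ.2 hρ
    rw [Set.Finite.mem_toFinset, ← (mk_eq_isoClass_iff ρ.2 ρ).2 ⟨.refl _⟩] at h
    exact h
  refine ⟨heq, ?_⟩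
  rw [heq, Set.ncard_union_eq d1 f1 (f2.union (f3.union f4)),
    Set.ncard_union_eq d2 f2 (f3.union f4), Set.ncard_union_eq d34 f3 f4, n1, n3]
  rw [hk] at n2 n4 ⊢
  simp only [show k + 3 - 1 = k + 2 by omega, show k + 3 - 2 = k + 1 by omega] at n2 n4 ⊢
  have h9 : (k + 3) ^ 2 - 1 = (k + 2) * (k + 4) := by
    rw [Nat.sub_eq_iff_eq_add (by nlinarith)]
    ring
  rw [h9]
  refine Nat.eq_of_mul_eq_mul_left two_pos ?_
  linear_combination n2 + n4

end Counting

end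

end GL2Rep

theorem mainTheorem11 {F : Type*} [Field F] [Fintype F] [DecidableEq F] (hF : ringChar F ≠ 2)
    {E : Type*} [Field E] [Algebra F E] (b : Module.Basis (Fin 2) F E)
    (q : ℕ) (hq : Fintype.card F = q) :
    -- one-dimensional representations
    ((∀ ξ : Fˣ →* ℂˣ, (GL2Rep.detRep ξ).IsIrreducible) ∧
      (∀ ξ ξ' : Fˣ →* ℂˣ,
        Nonempty ((GL2Rep.detRep ξ).Equiv (GL2Rep.detRep ξ')) ↔ ξ = ξ') ∧
      (∀ (V : Type*) [AddCommGroup V] [Module ℂ V]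
        (ρ : Representation ℂ (Matrix.GeneralLinearGroup (Fin 2) F) V), Module.finrank ℂ V = 1 →
          ∃ ξ : Fˣ →* ℂˣ, Nonempty (ρ.Equiv (GL2Rep.detRep ξ))) ∧
      (GL2Rep.isoClasses fun ρ : GL2Rep.FinRep (Matrix.GeneralLinearGroup (Fin 2) F) =>
        ∃ ξ : Fˣ →* ℂˣ, Nonempty (ρ.2.Equiv (GL2Rep.detRep ξ))).ncard = q - 1) ∧
    -- principal series
    ((∀ l₁ l₂ : Fˣ →* ℂˣ,
        Module.finrank ℂ (Representation.coindV (GL2Rep.borel F).subtype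
          (GL2Rep.charRep (GL2Rep.borelChar l₁ l₂))) = q + 1) ∧
      (∀ l₁ l₂ : Fˣ →* ℂˣ, l₁ ≠ l₂ → (GL2Rep.principalSeries l₁ l₂).IsIrreducible) ∧
      (∀ l₁ l₂ l₁' l₂' : Fˣ →* ℂˣ, l₁ ≠ l₂ → l₁' ≠ l₂' →
        (Nonempty ((GL2Rep.principalSeries l₁ l₂).Equiv (GL2Rep.principalSeries l₁' l₂')) ↔
          ({l₁, l₂} : Set (Fˣ →* ℂˣ)) = {l₁', l₂'})) ∧
      (GL2Rep.isoClasses fun ρ : GL2Rep.FinRep (Matrix.GeneralLinearGroup (Fin 2) F) =>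
        ∃ l₁ l₂ : Fˣ →* ℂˣ, l₁ ≠ l₂ ∧
          Nonempty (ρ.2.Equiv (GL2Rep.principalSeries l₁ l₂))).ncard = (q - 1) * (q - 2) / 2) ∧
    -- the representations `W_μ`
    ((∀ μ : Fˣ →* ℂˣ, Nonempty ((GL2Rep.principalSeries μ μ).Equiv
        ((GL2Rep.detRep μ).prod (GL2Rep.steinberg μ)))) ∧
      (∀ μ : Fˣ →* ℂˣ, (GL2Rep.steinberg μ).IsIrreducible) ∧
      (∀ μ : Fˣ →* ℂˣ, Module.finrank ℂ (GL2Rep.SteinbergSpace μ) = q) ∧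
      (∀ μ μ' : Fˣ →* ℂˣ,
        Nonempty ((GL2Rep.steinberg μ).Equiv (GL2Rep.steinberg μ')) ↔ μ = μ') ∧
      (GL2Rep.isoClasses fun ρ : GL2Rep.FinRep (Matrix.GeneralLinearGroup (Fin 2) F) =>
        ∃ μ : Fˣ →* ℂˣ, Nonempty (ρ.2.Equiv (GL2Rep.steinberg μ))).ncard = q - 1) ∧
    -- complementary series, and the completeness of the list
    (∃ Y : (Eˣ →* ℂˣ) →
        Representation ℂ (Matrix.GeneralLinearGroup (Fin 2) F) (Fin (q - 1) → ℂ),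
      (∀ ν : Eˣ →* ℂˣ, ν ^ q ≠ ν →
        (Y ν).IsIrreducible ∧ ∀ g, (Y ν).character g = GL2Rep.complementaryChar b ν g) ∧
      (∀ ν ν' : Eˣ →* ℂˣ, ν ^ q ≠ ν → ν' ^ q ≠ ν' →
        (Nonempty ((Y ν).Equiv (Y ν')) ↔ ν' = ν ∨ ν' = ν ^ q)) ∧
      (GL2Rep.isoClasses fun ρ : GL2Rep.FinRep (Matrix.GeneralLinearGroup (Fin 2) F) =>
        ∃ ν : Eˣ →* ℂˣ, ν ^ q ≠ ν ∧ Nonempty (ρ.2.Equiv (Y ν))).ncard = q * (q - 1) / 2 ∧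
      (∀ (V : Type*) [AddCommGroup V] [Module ℂ V]
        (ρ : Representation ℂ (Matrix.GeneralLinearGroup (Fin 2) F) V), ρ.IsIrreducible →
          (∃ ξ : Fˣ →* ℂˣ, Nonempty (ρ.Equiv (GL2Rep.detRep ξ))) ∨
          (∃ l₁ l₂ : Fˣ →* ℂˣ, l₁ ≠ l₂ ∧
            Nonempty (ρ.Equiv (GL2Rep.principalSeries l₁ l₂))) ∨
          (∃ μ : Fˣ →* ℂˣ, Nonempty (ρ.Equiv (GL2Rep.steinberg μ))) ∨
          (∃ ν : Eˣ →* ℂˣ, ν ^ q ≠ ν ∧ Nonempty (ρ.Equiv (Y ν))))) ∧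
    -- the number of irreducible representations
    (GL2Rep.isoClasses fun ρ : GL2Rep.FinRep (Matrix.GeneralLinearGroup (Fin 2) F) =>
      ρ.2.IsIrreducible).ncard = q ^ 2 - 1 := by
  classical
  subst hq
  have : Module.Finite F E := .of_basis b
  have : Finite E := Module.finite_of_finite F
  have := Fintype.ofFinite E
  obtain ⟨hlist, htotal⟩ := GL2Rep.isoClasses_isIrreducible_eq b hF
  have hq := GL2Rep.three_le_card hF
  refine ⟨⟨GL2Rep.isIrreducible_detRep, GL2Rep.detRep_equiv_iff, ?_, ?_⟩,
    ⟨GL2Rep.finrank_principalSeries, fun _ _ => GL2Rep.isIrreducible_principalSeries, ?_, ?_⟩,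
    ⟨GL2Rep.principalSeries_equiv_prod, GL2Rep.isIrreducible_steinberg,
      GL2Rep.finrank_steinbergSpace, GL2Rep.steinberg_equiv_iff, ?_⟩,
    ⟨GL2Rep.complementarySeries b, ?_, ?_, ?_, ?_⟩, htotal⟩
  · intro V _ _ ρ hV
    have : FiniteDimensional ℂ V := Module.finite_of_finrank_pos (by omega)
    have hρ := GL2Rep.isoClass_mem_isoClasses (GL2Rep.isIrreducible_of_finrank_eq_one ρ hV)
    have hdim : GL2Rep.classDim (GL2Rep.isoClass ρ) = 1 := hV
    -- The other families of the list have dimensions `q + 1`, `q` and `q - 1`.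
    rw [hlist] at hρ
    rcases hρ with ⟨ξ, -, hξ⟩ | h | h | h
    · exact ⟨ξ, (GL2Rep.isoClass_eq_iff _ _).1 hξ.symm⟩
    · have := GL2Rep.classDim_of_mem_principalClasses h
      omega
    · have := GL2Rep.classDim_of_mem_steinbergClasses h
      omega
    · have := GL2Rep.classDim_of_mem_complementaryClasses b h
      omega
  · rw [GL2Rep.isoClasses_eq_image (fun ξ : Fˣ →* ℂˣ => GL2Rep.detRep ξ) Set.univ (by simp)]
    exact GL2Rep.ncard_detClasses
  · intro l₁ l₂ l₁' l₂' h h'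
    rw [GL2Rep.principalSeries_equiv_iff h h', Set.pair_eq_pair_iff]
  · rw [GL2Rep.isoClasses_eq_image (fun p : (Fˣ →* ℂˣ) × (Fˣ →* ℂˣ) =>
      GL2Rep.principalSeries p.1 p.2) {p | p.1 ≠ p.2} (by simp)]
    exact Nat.eq_div_of_mul_eq_right two_ne_zero GL2Rep.two_mul_ncard_principalClasses
  · rw [GL2Rep.isoClasses_eq_image (fun μ : Fˣ →* ℂˣ => GL2Rep.steinberg μ) Set.univ (by simp)]
    exact GL2Rep.ncard_steinbergClasses
  · exact fun ν hν => ⟨GL2Rep.isIrreducible_complementarySeries hν,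
      congrFun (GL2Rep.character_complementarySeries hν)⟩
  · exact fun ν ν' hν hν' => GL2Rep.complementarySeries_equiv_iff hν hν'
  · rw [GL2Rep.isoClasses_eq_image (fun ν : Eˣ →* ℂˣ => GL2Rep.complementarySeries b ν)
      {ν | ν ^ Fintype.card F ≠ ν} (by simp)]
    exact Nat.eq_div_of_mul_eq_right two_ne_zero (GL2Rep.two_mul_ncard_complementaryClasses b)
  · intro V _ _ ρ hρ
    have := GL2Rep.finiteDimensional_of_isIrreducible ρ hρ
    have hmem := GL2Rep.isoClass_mem_isoClasses hρ
    rw [hlist] at hmem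
    rcases hmem with ⟨ξ, -, h⟩ | ⟨p, hp, h⟩ | ⟨μ, -, h⟩ | ⟨ν, hν, h⟩
    · exact Or.inl ⟨ξ, (GL2Rep.isoClass_eq_iff _ _).1 h.symm⟩
    · exact Or.inr (Or.inl ⟨p.1, p.2, hp, (GL2Rep.isoClass_eq_iff _ _).1 h.symm⟩)
    · exact Or.inr (Or.inr (Or.inl ⟨μ, (GL2Rep.isoClass_eq_iff _ _).1 h.symm⟩))
    · exact Or.inr (Or.inr (Or.inr ⟨ν, hν, (GL2Rep.isoClass_eq_iff _ _).1 h.symm⟩))
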